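/- Let $N\in\mathbb{N}$, write $u'Jv=\sum_{i=1}^N(q_i\tilde p_i-p_i\tilde q_i)$ for the symplectic product of $u=(q,p)$ and $v=(\tilde q,\tilde p)$ in $\mathbb{R}^{2N}$, $u^2$ for the squared Euclidean norm, and let $dx=(2\pi)^{-N}d^{2N}x$ be normalized Lebesgue measure. Let $\mathcal{S}_2=\mathcal{S}(\mathbb{R}^{2N})$ be the Schwartz space of complex-valued functions and $\mathcal{S}_2'$ its dual with the strong topology (uniform convergence on bounded subsets of $\mathcal{S}_2$). For $f,g\in\mathcal{S}_2$ let $\check f(u)=f(-u)$ and $$(f\times g)(u)=\iint f(u+s)\,g(u+t)\,e^{is'Jt}\,ds\,dt,\qquad (f\natural g)(u)=\int f(u-t)\,g(t)\,e^{-iu'Jt}\,dt ,$$ both of which lie in $\mathcal{S}_2$. For $T\in\mathcal{S}_2'$ and $f\in\mathcal{S}_2$ define $T\times f$, $f\times T$, $T\natural f$, $f\natural T\in\mathcal{S}_2'$ by $$\langle T\times f,h\rangle=\langle T,f\times h\rangle,\quad \langle f\times T,h\rangle=\langle T,h\times f\rangle,\quad \langle T\natural f,h\rangle=\langle T,\check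 f\natural h\rangle,\quad \langle f\natural T,h\rangle=\langle T,h\natural\check f\rangle\qquad(h\in\mathcal{S}_2).$$ For $k,m\in\mathbb{N}$ let $\mathcal{V}_k^m$ be the space of all $f\in C^m(\mathbb{R}^{2N})$ such that $(1+u^2)^{-k-|\alpha|/2}\,\partial^\alpha f(u)$ vanishes at infinity for all $|\alpha|\le m$, normed by $$p_{k,m}(f)=\sup\{(1+u^2)^{-k-|\alpha|/2}\,|\partial^\alpha f(u)| : u\in\mathbb{R}^{2N},\ |\alpha|\le m\}.$$ Let $\mathcal{V}_k=\bigcap_{m}\mathcal{V}_k^m$ with the projective topology (the weakest locally convex topology making all inclusions $\mathcal{V}_k\subset\mathcal{V}_k^m$ continuous), and $\mathcal{O}_T=\bigcup_{k}\mathcal{V}_k$ with the inductive topology (the strongest locally convex topology making all inclusions $\mathcal{V}_k\subset\mathcal{O}_T$ continuous). A function $g\in\mathcal{O}_T$ is identified with the tempered distribution $h\mapsto\int g(u)h(u)\,du$ (again with the normalized measure). Theorem. If $T\in\mathcal{S}_2'$ and $f\in\mathcal{S}_2$, then $T\times f$, $f\times T$, $T\natural f$ and $f\natural T$ all lie in $\mathcal{O}_T$.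 Moreover, the four bilinear maps $(T,f)\mapsto T\times f$, $f\times T$, $T\natural f$, $f\natural T$ of $\mathcal{S}_2'\times\mathcal{S}_2$ into $\mathcal{O}_T$ are separately continuous. -/

import Mathlib

open MeasureTheory Filter Topology
open scoped SchwartzMap LineDeriv ContDiff NNReal

noncomputable section

namespace Moyal

/-- Phase space `ℝ^{2N}`; the coordinate `Sum.inl i` is `q_i`, the coordinate `Sum.inr i` is
`p_i`. -/
abbrev Phase (N : ℕ) : Type := EuclideanSpace ℝ (Fin N ⊕ Fin N)

/-- The space `𝓢₂` of complex-valued Schwartz functions on `ℝ^{2N}`. -/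
abbrev S2 (N : ℕ) : Type := 𝓢(Phase N, ℂ)

/-- The space `𝓢₂'` of tempered distributions on `ℝ^{2N}`. With Mathlib's topology on spaces of
continuous linear maps, this is the strong dual: uniform convergence on bounded subsets of
`𝓢₂`. -/
abbrev S2' (N : ℕ) : Type := S2 N →L[ℂ] ℂ

variable {N : ℕ}

/-- The symplectic product `u'Jv = ∑ i, (q_i q̃p_i - p_i q̃q_i)`. -/
def symp (u v : Phase N) : ℝ :=
  ∑ i : Fin N, (u (Sum.inl i) * v (Sum.inr i) - u (Sum.inr i) * v (Sum.inl i))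

/-- The normalized Haar measure `dx = (2π)^{-N} d^{2N}x`. -/
def dx (N : ℕ) : Measure (Phase N) :=
  ENNReal.ofReal ((2 * Real.pi) ^ N)⁻¹ • (volume : Measure (Phase N))

instance (N : ℕ) : (dx N).IsAddHaarMeasure :=
  Measure.IsAddHaarMeasure.smul _ (by simp; positivity) ENNReal.ofReal_ne_top

/-- The reflection `f ↦ f̌`, `f̌(u) = f(-u)`. -/
def check : S2 N →L[ℂ] S2 N :=
  SchwartzMap.compCLMOfContinuousLinearEquiv ℂ (ContinuousLinearEquiv.neg ℝ)

theorem check_apply (f : S2 N) (u : Phase N) : check f u = f (-u) := rfl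

/-- The twisted convolution `(f ♮ g)(u) = ∫ f(u - t) g(t) exp(-i u'Jt) dt`, as a function. -/
def twistedConvFun (f g : S2 N) (u : Phase N) : ℂ :=
  ∫ t, f (u - t) * g t * Complex.exp (-(Complex.I * (symp u t : ℂ))) ∂(dx N)

/-- The twisted product `(f × g)(u) = ∬ f(u + s) g(u + t) exp(i s'Jt) ds dt`, as a function. -/
def twistedProdFun (f g : S2 N) (u : Phase N) : ℂ :=
  ∫ t, ∫ s, f (u + s) * g (u + t) * Complex.exp (Complex.I * (symp s t : ℂ)) ∂(dx N) ∂(dx N)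

/-- The symplectic product as a continuous bilinear map. -/
def sympCLM (N : ℕ) : Phase N →L[ℝ] Phase N →L[ℝ] ℝ :=
  (LinearMap.mk₂ ℝ (symp (N := N))
    (fun u u' v => by simp only [symp, ← Finset.sum_add_distrib]; congr! 1; simp; ring)
    (fun c u v => by simp only [symp, Finset.smul_sum]; congr! 1; simp; ring)
    (fun u v v' => by simp only [symp, ← Finset.sum_add_distrib]; congr! 1; simp; ring)
    (fun c u v => by
      simp only [symp, Finset.smul_sum]; congr! 1; simp; ring)).toContinuousBilinearMap

theorem sympCLM_apply (u v : Phase N) : sympCLM N u v = symp u v := rfl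

theorem exists_seminorm_bound (k : ℕ) :
    ∃ p : Seminorm ℂ (S2 N), Continuous p ∧ ∀ f x, (1 + ‖x‖) ^ k * ‖f x‖ ≤ p f := by
  refine ⟨((2 : ℝ≥0) ^ k) • ((Finset.Iic (k, 0)).sup (schwartzSeminormFamily ℂ (Phase N) ℂ) :
      Seminorm ℂ (S2 N)),
    ?_, fun f x => ?_⟩
  · have : Continuous ((Finset.Iic (k, 0)).sup (schwartzSeminormFamily ℂ (Phase N) ℂ) :
        Seminorm ℂ (S2 N)) :=
      Seminorm.continuous_finsetSup fun i _ =>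
        (schwartz_withSeminorms ℂ (Phase N) ℂ).continuous_seminorm i
    exact this.const_smul ((2 : ℝ≥0) ^ k)
  · have := SchwartzMap.one_add_le_sup_seminorm_apply (𝕜 := ℂ) (m := (k, 0)) (k := k) (n := 0)
      le_rfl le_rfl f x
    rw [norm_iteratedFDeriv_zero] at this
    exact this

theorem norm_phase (u t : Phase N) :
    ‖Complex.exp (-(Complex.I * (symp u t : ℂ)))‖ = 1 := by
  rw [Complex.norm_exp]; simp

theorem continuous_symp : Continuous fun x : Phase N × Phase N => symp x.1 x.2 :=
  (sympCLM N).continuous₂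

theorem continuous_integrand (f g : S2 N) (u : Phase N) :
    Continuous fun t => f (u - t) * g t * Complex.exp (-(Complex.I * (symp u t : ℂ))) := by
  have h : Continuous fun t => symp u t := (sympCLM N u).continuous
  have := f.continuous
  have := g.continuous
  fun_prop

theorem integrable_integrand (f g : S2 N) (u : Phase N) :
    Integrable (fun t => f (u - t) * g t * Complex.exp (-(Complex.I * (symp u t : ℂ)))) (dx N) := by
  obtain ⟨p, -, hp⟩ := exists_seminorm_bound (N := N) 0
  refine (g.integrable (μ := dx N)).norm.const_mul (p f) |>.mono'
    (continuous_integrand f g u).aestronglyMeasurable (ae_of_all _ fun t => ?_)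
  rw [norm_mul, norm_mul, norm_phase, mul_one]
  gcongr
  simpa using hp f (u - t)

/-- `t ↦ -i (m'Jt) g(t)`. -/
def mulSymp (m : Phase N) : S2 N →L[ℂ] S2 N :=
  SchwartzMap.smulLeftCLM ℂ (fun t : Phase N => -(Complex.I * (sympCLM N m t : ℂ)))

theorem mulSymp_apply (m : Phase N) (g : S2 N) (t : Phase N) :
    mulSymp m g t = -(Complex.I * (symp m t : ℂ)) * g t := by
  unfold mulSymp
  rw [SchwartzMap.smulLeftCLM_apply_apply, sympCLM_apply, smul_eq_mul]
  have h : (fun t : Phase N => -(Complex.I * (sympCLM N m t : ℂ))) =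
    ((-Complex.I) • (Complex.ofRealCLM.comp (sympCLM N m)) : Phase N →L[ℝ] ℂ) := by
    ext; simp
  rw [h]
  exact ContinuousLinearMap.hasTemperateGrowth _

theorem hasFDerivAt_twistedConvFun (f g : S2 N) (u : Phase N) :
    ∃ L : Phase N →L[ℝ] ℂ, HasFDerivAt (twistedConvFun f g) L u ∧
      ∀ m, L m = twistedConvFun (∂_{m} f) g u + twistedConvFun f (mulSymp m g) u := by
  set F' : Phase N → Phase N → Phase N →L[ℝ] ℂ := fun u t =>
    (g t * Complex.exp (-(Complex.I * (symp u t : ℂ)))) • fderiv ℝ f (u - t) +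
    (f (u - t) * g t * Complex.exp (-(Complex.I * (symp u t : ℂ)))) •
      ((-Complex.I) • Complex.ofRealCLM.comp ((sympCLM N).flip t)) with hF'
  obtain ⟨p, -, hp⟩ := exists_seminorm_bound (N := N) 0
  have hfd : ∀ x, ‖fderiv ℝ f x‖ ≤ SchwartzMap.seminorm ℝ 0 1 f := fun x => by
    have := SchwartzMap.le_seminorm ℝ 0 1 f x
    rw [pow_zero, one_mul, ← norm_iteratedFDeriv_fderiv, norm_iteratedFDeriv_zero] at this
    exact this
  have hdiff : ∀ t x, HasFDerivAt
      (fun u => f (u - t) * g t * Complex.exp (-(Complex.I * (symp u t : ℂ)))) (F' x t) x := by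
    intro t x
    have h1 : HasFDerivAt (fun u => f (u - t)) (fderiv ℝ f (x - t)) x :=
      (hasFDerivAt_comp_sub t).2 (f.hasFDerivAt (x - t))
    have h2 : HasFDerivAt (fun u : Phase N => -(Complex.I * (symp u t : ℂ)))
        ((-Complex.I) • Complex.ofRealCLM.comp ((sympCLM N).flip t)) x := by
      have := ((-Complex.I) • Complex.ofRealCLM.comp ((sympCLM N).flip t)).hasFDerivAt (x := x)
      convert! this using 1
      ext u; simp [sympCLM_apply]
    convert! (h1.mul_const (g t)).mul h2.cexp using 1
    ext m
    simp only [hF', add_apply, smul_apply, smul_eq_mul]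
    ring
  have hcont : Continuous (F' u) := by
    have h : Continuous fun t => symp u t := (sympCLM N u).continuous
    have := f.continuous
    have := g.continuous
    have h3 : Continuous (fderiv ℝ f) := (f.smooth 1).continuous_fderiv (by simp)
    have h4 : Continuous fun t => (sympCLM N).flip t := (sympCLM N).flip.continuous
    have h5 : Continuous fun t => Complex.ofRealCLM.comp ((sympCLM N).flip t) :=
      continuous_const.clm_comp h4
    exact ((by fun_prop : Continuous fun t =>
      g t * Complex.exp (-(Complex.I * (symp u t : ℂ)))).smul (h3.comp (by fun_prop))).add
      ((continuous_integrand f g u).smul (h5.const_smul (-Complex.I)))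
  set b : Phase N → ℝ := fun t => SchwartzMap.seminorm ℝ 0 1 f * ‖g t‖ +
    p f * ‖(sympCLM N).flip‖ * (‖t‖ ^ 1 * ‖g t‖) with hb
  have hbi : Integrable b (dx N) :=
    (g.integrable.norm.const_mul _).add ((g.integrable_pow_mul (dx N) 1).const_mul _)
  have hbound : ∀ t x, ‖F' x t‖ ≤ b t := by
    intro t x
    refine (norm_add_le _ _).trans (add_le_add ?_ ?_)
    · rw [norm_smul, norm_mul, norm_phase, mul_one, mul_comm]
      gcongr
      exact hfd _
    · rw [norm_smul, norm_smul, norm_mul, norm_mul, norm_phase, mul_one, norm_neg, Complex.norm_I,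
        one_mul]
      have h1 : ‖Complex.ofRealCLM.comp ((sympCLM N).flip t)‖ ≤ ‖(sympCLM N).flip‖ * ‖t‖ :=
        (ContinuousLinearMap.opNorm_comp_le _ _).trans (by
          rw [Complex.ofRealCLM_norm, one_mul]; exact ContinuousLinearMap.le_opNorm _ _)
      have h2 : ‖f (x - t)‖ ≤ p f := by simpa using hp f (x - t)
      have h0 : 0 ≤ p f := apply_nonneg _ _
      calc _ ≤ p f * ‖g t‖ * (‖(sympCLM N).flip‖ * ‖t‖) := by gcongr
        _ = _ := by ring
  have hint : Integrable (F' u) (dx N) :=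
    hbi.mono' hcont.aestronglyMeasurable (ae_of_all _ fun t => hbound t u)
  refine ⟨∫ t, F' u t ∂(dx N), ?_, fun m => ?_⟩
  · exact hasFDerivAt_integral_of_dominated_of_fderiv_le (s := Set.univ) univ_mem
      (Eventually.of_forall fun x => (continuous_integrand f g x).aestronglyMeasurable)
      (integrable_integrand f g u) hcont.aestronglyMeasurable
      (ae_of_all _ fun t x _ => hbound t x) hbi (ae_of_all _ fun t x _ => hdiff t x)
  · rw [ContinuousLinearMap.integral_apply hint]
    unfold twistedConvFun
    rw [← integral_add (integrable_integrand _ g u) (integrable_integrand f _ u)]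
    congr 1
    ext t
    simp only [hF', add_apply, smul_apply, smul_eq_mul,
      mulSymp_apply, SchwartzMap.lineDerivOp_apply_eq_fderiv, ContinuousLinearMap.comp_apply,
      ContinuousLinearMap.flip_apply, sympCLM_apply, Complex.ofRealCLM_apply]
    ring

theorem fderiv_twistedConvFun (f g : S2 N) :
    fderiv ℝ (twistedConvFun f g) = fun u => ∑ j : Fin N ⊕ Fin N,
      ((ContinuousLinearMap.smulRightL ℝ (Phase N) ℂ (EuclideanSpace.proj j))
        (twistedConvFun (∂_{(EuclideanSpace.single j (1 : ℝ) : Phase N)} f) g u +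
          twistedConvFun f (mulSymp (EuclideanSpace.single j (1 : ℝ)) g) u)) := by
  ext u m
  obtain ⟨L, hL, hLm⟩ := hasFDerivAt_twistedConvFun f g u
  rw [hL.fderiv]
  have hm : m = ∑ j, m j • (EuclideanSpace.single j (1 : ℝ) : Phase N) := by
    ext i
    simp only [WithLp.ofLp_sum, Finset.sum_apply, WithLp.ofLp_smul, Pi.smul_apply, smul_eq_mul,
      PiLp.single_apply, mul_ite, mul_one, mul_zero, Finset.sum_ite_eq,
      Finset.mem_univ, if_true]
  conv_lhs => rw [hm]
  simp [map_sum, ← hLm]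

theorem contDiff_twistedConvFun (n : ℕ) : ∀ f g : S2 N, ContDiff ℝ n (twistedConvFun f g) := by
  induction n with
  | zero =>
    intro f g
    refine contDiff_zero.2 (continuous_iff_continuousAt.2 fun u => ?_)
    obtain ⟨L, hL, -⟩ := hasFDerivAt_twistedConvFun f g u
    exact hL.continuousAt
  | succ n ih =>
    intro f g
    push_cast
    refine contDiff_succ_iff_fderiv.2 ⟨fun u => ?_, by simp, ?_⟩
    · obtain ⟨L, hL, -⟩ := hasFDerivAt_twistedConvFun f g u
      exact hL.differentiableAt
    · rw [fderiv_twistedConvFun]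
      exact ContDiff.sum fun j _ => (ContinuousLinearMap.contDiff _).comp ((ih _ _).add (ih _ _))

theorem exists_bound_twistedConvFun (k : ℕ) :
    ∃ p q : Seminorm ℂ (S2 N), Continuous p ∧ Continuous q ∧
      ∀ f g u, ‖u‖ ^ k * ‖twistedConvFun f g u‖ ≤ p f * q g := by
  obtain ⟨p, hpc, hp⟩ := exists_seminorm_bound (N := N) k
  obtain ⟨q, hqc, hq⟩ := exists_seminorm_bound (N := N) (k + (dx N).integrablePower)
  set r := (dx N).integrablePower with hr
  have hint := Measure.integrable_pow_neg_integrablePower (dx N)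
  set c : ℝ := ∫ x, (1 + ‖x‖) ^ (-(r : ℝ)) ∂(dx N) with hc
  have hc0 : 0 ≤ c := integral_nonneg fun x => by positivity
  refine ⟨p, c.toNNReal • q, hpc, hqc.const_smul c.toNNReal, fun f g u => ?_⟩
  have hpf : 0 ≤ p f := apply_nonneg _ _
  have key : ∀ t, ‖u‖ ^ k * ‖f (u - t) * g t * Complex.exp (-(Complex.I * (symp u t : ℂ)))‖ ≤
      p f * q g * (1 + ‖t‖) ^ (-(r : ℝ)) := by
    intro t
    have h1 := hp f (u - t)
    have h2 := hq g t
    have h3 : ‖u‖ ≤ (1 + ‖u - t‖) * (1 + ‖t‖) := by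
      have := norm_add_le (u - t) t
      rw [sub_add_cancel] at this
      nlinarith [norm_nonneg (u - t), norm_nonneg t]
    rw [norm_mul, norm_mul, norm_phase, mul_one]
    have h4 : (1 + ‖t‖) ^ k * ‖g t‖ ≤ q g * (1 + ‖t‖) ^ (-(r : ℝ)) := by
      rw [Real.rpow_neg (by positivity), ← div_eq_mul_inv, le_div_iff₀ (by positivity),
        Real.rpow_natCast]
      calc _ = (1 + ‖t‖) ^ (k + r) * ‖g t‖ := by ring
        _ ≤ _ := h2
    calc ‖u‖ ^ k * (‖f (u - t)‖ * ‖g t‖)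
        ≤ ((1 + ‖u - t‖) * (1 + ‖t‖)) ^ k * (‖f (u - t)‖ * ‖g t‖) := by gcongr
      _ = ((1 + ‖u - t‖) ^ k * ‖f (u - t)‖) * ((1 + ‖t‖) ^ k * ‖g t‖) := by rw [mul_pow]; ring
      _ ≤ p f * (q g * (1 + ‖t‖) ^ (-(r : ℝ))) := by gcongr
      _ = _ := by ring
  calc ‖u‖ ^ k * ‖twistedConvFun f g u‖
      ≤ ‖u‖ ^ k * ∫ t, ‖f (u - t) * g t * Complex.exp (-(Complex.I * (symp u t : ℂ)))‖ ∂(dx N) := by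
        gcongr; exact norm_integral_le_integral_norm _
    _ = ∫ t, ‖u‖ ^ k * ‖f (u - t) * g t * Complex.exp (-(Complex.I * (symp u t : ℂ)))‖ ∂(dx N) :=
        (integral_const_mul _ _).symm
    _ ≤ ∫ t, p f * q g * (1 + ‖t‖) ^ (-(r : ℝ)) ∂(dx N) :=
        integral_mono ((integrable_integrand f g u).norm.const_mul _) (hint.const_mul _) key
    _ = p f * (c * q g) := by rw [integral_const_mul]; ring
    _ = p f * (c.toNNReal • q) g := by
        rw [smul_apply, NNReal.smul_def, Real.coe_toNNReal _ hc0, smul_eq_mul]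

theorem exists_bound_iteratedFDeriv (k n : ℕ) :
    ∃ p q : Seminorm ℂ (S2 N), Continuous p ∧ Continuous q ∧
      ∀ f g u, ‖u‖ ^ k * ‖iteratedFDeriv ℝ n (twistedConvFun f g) u‖ ≤ p f * q g := by
  induction n with
  | zero => simpa using exists_bound_twistedConvFun (N := N) k
  | succ n ih =>
    obtain ⟨p, q, hpc, hqc, h⟩ := ih
    let e : Fin N ⊕ Fin N → Phase N := fun j => EuclideanSpace.single j (1 : ℝ)
    let A : (Fin N ⊕ Fin N) → (ℂ →L[ℝ] (Phase N →L[ℝ] ℂ)) := fun j =>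
      ContinuousLinearMap.smulRightL ℝ (Phase N) ℂ (EuclideanSpace.proj j)
    let D : (Fin N ⊕ Fin N) → (S2 N →L[ℂ] S2 N) := fun j =>
      LineDeriv.lineDerivOpCLM ℂ (S2 N) (e j)
    let M : (Fin N ⊕ Fin N) → (S2 N →L[ℂ] S2 N) := fun j => mulSymp (e j)
    let P : Seminorm ℂ (S2 N) :=
      ∑ j, (‖A j‖₊ • (p.comp (D j).toLinearMap) + ‖A j‖₊ • p)
    let Q : Seminorm ℂ (S2 N) := ∑ j, (q + q.comp (M j).toLinearMap)
    have hPc : Continuous P := Seminorm.continuous_finsetSum fun j _ =>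
      ((hpc.comp (D j).continuous).const_smul ‖A j‖₊).add (hpc.const_smul ‖A j‖₊)
    have hQc : Continuous Q := Seminorm.continuous_finsetSum fun j _ =>
      hqc.add (hqc.comp (M j).continuous)
    refine ⟨P, Q, hPc, hQc, fun f g u => ?_⟩
    have hP : P f = ∑ j, (‖A j‖ * p (D j f) + ‖A j‖ * p f) := by
      simp [P, sum_apply, NNReal.smul_def]
    have hQ : Q g = ∑ j, (q g + q (M j g)) := by
      simp [Q, sum_apply]
    rw [← norm_iteratedFDeriv_fderiv, fderiv_twistedConvFun]
    have hcd : ∀ j, ContDiff ℝ n (fun u => twistedConvFun (D j f) g u +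
        twistedConvFun f (M j g) u) := fun j =>
      (contDiff_twistedConvFun n _ _).add (contDiff_twistedConvFun n _ _)
    have hsum : iteratedFDeriv ℝ n (fun u => ∑ j, A j (twistedConvFun (D j f) g u +
        twistedConvFun f (M j g) u)) u = ∑ j, iteratedFDeriv ℝ n (fun u =>
        A j (twistedConvFun (D j f) g u + twistedConvFun f (M j g) u)) u := by
      exact iteratedFDeriv_fun_sum_apply fun j _ => ((A j).contDiff.comp (hcd j)).contDiffAt
    have hterm : ∀ j, ‖u‖ ^ k * ‖iteratedFDeriv ℝ n (fun u =>
        A j (twistedConvFun (D j f) g u + twistedConvFun f (M j g) u)) u‖ ≤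
        (‖A j‖ * p (D j f) + ‖A j‖ * p f) * (q g + q (M j g)) := by
      intro j
      have h1 := (A j).norm_iteratedFDeriv_comp_left (x := u) (n := n) (hcd j).contDiffAt le_rfl
      have h2 : iteratedFDeriv ℝ n (fun u => twistedConvFun (D j f) g u +
          twistedConvFun f (M j g) u) u = iteratedFDeriv ℝ n (twistedConvFun (D j f) g) u +
            iteratedFDeriv ℝ n (twistedConvFun f (M j g)) u :=
        iteratedFDeriv_add_apply (contDiff_twistedConvFun n _ _).contDiffAt
          (contDiff_twistedConvFun n _ _).contDiffAt
      have h3 := h (D j f) g u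
      have h4 := h f (M j g) u
      have n1 : 0 ≤ p (D j f) := apply_nonneg _ _
      have n2 : 0 ≤ p f := apply_nonneg _ _
      have n3 : 0 ≤ q g := apply_nonneg _ _
      have n4 : 0 ≤ q (M j g) := apply_nonneg _ _
      have n5 : 0 ≤ ‖A j‖ := norm_nonneg (A j)
      calc _ ≤ ‖u‖ ^ k * (‖A j‖ * (‖iteratedFDeriv ℝ n (twistedConvFun (D j f) g) u‖ +
            ‖iteratedFDeriv ℝ n (twistedConvFun f (M j g)) u‖)) := by
            gcongr
            refine h1.trans ?_
            rw [h2]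
            gcongr
            exact norm_add_le _ _
        _ = ‖A j‖ * (‖u‖ ^ k * ‖iteratedFDeriv ℝ n (twistedConvFun (D j f) g) u‖ +
            ‖u‖ ^ k * ‖iteratedFDeriv ℝ n (twistedConvFun f (M j g)) u‖) := by ring
        _ ≤ ‖A j‖ * (p (D j f) * q g + p f * q (M j g)) := by gcongr
        _ ≤ _ := by
            have := mul_nonneg n5 (mul_nonneg n1 n4)
            have := mul_nonneg n5 (mul_nonneg n2 n3)
            nlinarith
    change ‖u‖ ^ k * ‖iteratedFDeriv ℝ n (fun u => ∑ j, A j (twistedConvFun (D j f) g u +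
        twistedConvFun f (M j g) u)) u‖ ≤ _
    rw [hsum, hP, hQ]
    have n1 : ∀ j, 0 ≤ ‖A j‖ * p (D j f) + ‖A j‖ * p f := fun j => by positivity
    have n2 : ∀ j, 0 ≤ q g + q (M j g) := fun j => by positivity
    calc _ ≤ ‖u‖ ^ k * ∑ j, ‖iteratedFDeriv ℝ n (fun u =>
        A j (twistedConvFun (D j f) g u + twistedConvFun f (M j g) u)) u‖ := by
          gcongr; exact norm_sum_le _ _
      _ ≤ ∑ j, (‖A j‖ * p (D j f) + ‖A j‖ * p f) * (q g + q (M j g)) := by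
          rw [Finset.mul_sum]; exact Finset.sum_le_sum fun j _ => hterm j
      _ ≤ ∑ j, (‖A j‖ * p (D j f) + ‖A j‖ * p f) * ∑ j, (q g + q (M j g)) := by
          refine Finset.sum_le_sum fun j _ => mul_le_mul_of_nonneg_left ?_ (n1 j)
          exact Finset.single_le_sum (f := fun j => q g + q (M j g)) (fun i _ => n2 i)
            (Finset.mem_univ j)
      _ = _ := (Finset.sum_mul _ _ _).symm

/-- The twisted convolution `f ♮ g` of two Schwartz functions, as a Schwartz function. -/
def twistedConv (f g : S2 N) : S2 N where
  toFun := twistedConvFun f g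
  smooth' := contDiff_infty.2 fun n => contDiff_twistedConvFun n f g
  decay' k n := by
    obtain ⟨p, q, -, -, h⟩ := exists_bound_iteratedFDeriv (N := N) k n
    exact ⟨p f * q g, h f g⟩

theorem twistedConv_apply (f g : S2 N) (u : Phase N) :
    twistedConv f g u =
      ∫ t, f (u - t) * g t * Complex.exp (-(Complex.I * (symp u t : ℂ))) ∂(dx N) := rfl

theorem exists_finset_bound {p : Seminorm ℂ (S2 N)} (hp : Continuous p) (a : ℝ) (ha : 0 ≤ a) :
    ∃ (s : Finset (ℕ × ℕ)) (C : ℝ), 0 ≤ C ∧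
      ∀ f, a * p f ≤ C * s.sup (schwartzSeminormFamily ℂ (Phase N) ℂ) f := by
  obtain ⟨s, C, -, h⟩ := Seminorm.bound_of_continuous (schwartz_withSeminorms ℂ (Phase N) ℂ) p hp
  refine ⟨s, a * C, by positivity, fun f => ?_⟩
  have := h f
  rw [smul_apply, NNReal.smul_def, smul_eq_mul] at this
  calc a * p f ≤ a * _ := mul_le_mul_of_nonneg_left this ha
    _ = _ := (mul_assoc _ _ _).symm

/-- The continuous linear map `h ↦ f ♮ h` of `𝓢₂`. -/
def twistedConvLeft (f : S2 N) : S2 N →L[ℂ] S2 N :=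
  SchwartzMap.mkCLM (fun h => twistedConv f h)
    (fun g h u => by
      simp only [twistedConv_apply]
      rw [← integral_add (integrable_integrand f g u) (integrable_integrand f h u)]
      congr 1; ext t; simp only [add_apply]; ring)
    (fun a h u => by
      simp only [twistedConv_apply, RingHom.id_apply, smul_eq_mul]
      rw [← integral_const_mul]
      congr 1; ext t; simp only [smul_apply, smul_eq_mul]; ring)
    (fun h => (twistedConv f h).smooth ⊤)
    (fun n => by
      obtain ⟨p, q, -, hq, h⟩ := exists_bound_iteratedFDeriv (N := N) n.1 n.2
      obtain ⟨s, C, hC, hs⟩ := exists_finset_bound hq (p f) (apply_nonneg _ _)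
      exact ⟨s, C, hC, fun g u => (h f g u).trans (hs g)⟩)

/-- The continuous linear map `h ↦ h ♮ g` of `𝓢₂`. -/
def twistedConvRight (g : S2 N) : S2 N →L[ℂ] S2 N :=
  SchwartzMap.mkCLM (fun h => twistedConv h g)
    (fun f h u => by
      simp only [twistedConv_apply]
      rw [← integral_add (integrable_integrand f g u) (integrable_integrand h g u)]
      congr 1; ext t; simp only [add_apply]; ring)
    (fun a h u => by
      simp only [twistedConv_apply, RingHom.id_apply, smul_eq_mul]
      rw [← integral_const_mul]
      congr 1; ext t; simp only [smul_apply, smul_eq_mul]; ring)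
    (fun h => (twistedConv h g).smooth ⊤)
    (fun n => by
      obtain ⟨p, q, hp, -, h⟩ := exists_bound_iteratedFDeriv (N := N) n.1 n.2
      obtain ⟨s, C, hC, hs⟩ := exists_finset_bound hp (q g) (apply_nonneg _ _)
      exact ⟨s, C, hC, fun f u => (h f g u).trans ((mul_comm _ _).trans_le (hs f))⟩)

theorem twistedConvLeft_apply (f h : S2 N) : twistedConvLeft f h = twistedConv f h := rfl

theorem twistedConvRight_apply (g h : S2 N) : twistedConvRight g h = twistedConv h g := rfl

/-- The linear automorphism `u ↦ (2π)⁻¹ J u` of phase space. -/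
def scaledJ (N : ℕ) : Phase N ≃ₗ[ℝ] Phase N where
  toFun u := WithLp.toLp 2
    (Sum.elim (fun i => (2 * Real.pi)⁻¹ * u (Sum.inr i)) fun i => -((2 * Real.pi)⁻¹ * u (Sum.inl i)))
  map_add' u v := by ext (i | i) <;> simp <;> ring
  map_smul' c u := by ext (i | i) <;> simp <;> ring
  invFun w := WithLp.toLp 2
    (Sum.elim (fun i => -((2 * Real.pi) * w (Sum.inr i))) fun i => (2 * Real.pi) * w (Sum.inl i))
  left_inv u := by ext (i | i) <;> simp <;> field_simp
  right_inv u := by ext (i | i) <;> simp <;> field_simp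

theorem inner_scaledJ (t u : Phase N) : 2 * Real.pi * inner ℝ t (scaledJ N u) = symp t u := by
  simp only [PiLp.inner_apply, Fintype.sum_sum_type, symp, Finset.mul_sum, mul_add,
    ← Finset.sum_add_distrib]
  congr! 1 with i
  simp [scaledJ]
  field_simp
  ring

/-- The symplectic Fourier transform `(Ff)(u) = ∫ f(t) exp(-i t'Ju) dt` on `𝓢₂`. -/
def sympFourier : S2 N →L[ℂ] S2 N :=
  (((2 * Real.pi) ^ N)⁻¹ : ℂ) •
    ((SchwartzMap.compCLMOfContinuousLinearEquiv ℂ (scaledJ N).toContinuousLinearEquiv).comp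
      (SchwartzMap.fourierTransformCLM ℂ))

theorem integral_dx (φ : Phase N → ℂ) :
    ∫ x, φ x ∂(dx N) = (((2 * Real.pi) ^ N)⁻¹ : ℂ) * ∫ x, φ x := by
  rw [dx, integral_smul_measure, ENNReal.toReal_ofReal (by positivity), Complex.real_smul]
  push_cast
  rfl

theorem sympFourier_apply (f : S2 N) (u : Phase N) :
    sympFourier f u = ∫ t, f t * Complex.exp (-(Complex.I * (symp t u : ℂ))) ∂(dx N) := by
  rw [integral_dx]
  change (((2 * Real.pi) ^ N)⁻¹ : ℂ) • (FourierTransform.fourier (f : Phase N → ℂ) (scaledJ N u)) = _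
  rw [smul_eq_mul, Real.fourier_eq']
  congr 2
  ext t
  rw [smul_eq_mul, mul_comm]
  congr 2
  rw [← inner_scaledJ]
  push_cast
  ring

theorem symp_sub_left (u v w : Phase N) : symp (u - v) w = symp u w - symp v w := by
  simp only [← sympCLM_apply, map_sub, sub_apply]

theorem symp_sub_right (u v w : Phase N) : symp u (v - w) = symp u v - symp u w := by
  simp only [← sympCLM_apply, map_sub]

theorem symp_self (u : Phase N) : symp u u = 0 := by
  simp [symp, mul_comm]

theorem symp_swap (u v : Phase N) : symp u v = -symp v u := by
  simp only [symp, ← Finset.sum_neg_distrib]; congr! 1; ring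

theorem twistedProdFun_eq (f g : S2 N) :
    twistedProdFun f g = twistedConvFun (sympFourier f) g := by
  ext u
  unfold twistedProdFun twistedConvFun
  rw [← integral_sub_right_eq_self _ u]
  congr 1
  ext t
  rw [← integral_sub_right_eq_self _ u, sympFourier_apply, mul_assoc, ← integral_mul_const]
  congr 1
  ext s
  rw [add_sub_cancel, add_sub_cancel]
  have h : Complex.exp (Complex.I * (symp (s - u) (t - u) : ℂ)) =
      Complex.exp (-(Complex.I * (symp s (u - t) : ℂ))) *
        Complex.exp (-(Complex.I * (symp u t : ℂ))) := by
    rw [← Complex.exp_add]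
    congr 1
    simp only [symp_sub_left, symp_sub_right, symp_self]
    push_cast
    ring
  rw [h]
  ring

/-- The twisted product `f × g` of two Schwartz functions, as a Schwartz function. -/
def twistedProd (f g : S2 N) : S2 N where
  toFun := twistedProdFun f g
  smooth' := by rw [twistedProdFun_eq]; exact (twistedConv (sympFourier f) g).smooth'
  decay' := by rw [twistedProdFun_eq]; exact (twistedConv (sympFourier f) g).decay'

theorem twistedProd_apply (f g : S2 N) (u : Phase N) :
    twistedProd f g u = ∫ t, ∫ s, f (u + s) * g (u + t) *
      Complex.exp (Complex.I * (symp s t : ℂ)) ∂(dx N) ∂(dx N) := rfl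

theorem twistedProd_eq (f g : S2 N) : twistedProd f g = twistedConv (sympFourier f) g := by
  ext u; exact congrFun (twistedProdFun_eq f g) u

/-- The continuous linear map `h ↦ f × h` of `𝓢₂`. -/
def twistedProdLeft (f : S2 N) : S2 N →L[ℂ] S2 N :=
  (twistedConvLeft (sympFourier f)).copy (fun h => twistedProd f h)
    (funext fun h => twistedProd_eq f h)

/-- The continuous linear map `h ↦ h × g` of `𝓢₂`. -/
def twistedProdRight (g : S2 N) : S2 N →L[ℂ] S2 N :=
  ((twistedConvRight g).comp sympFourier).copy (fun h => twistedProd h g)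
    (funext fun h => twistedProd_eq h g)

theorem twistedProdLeft_apply (f h : S2 N) : twistedProdLeft f h = twistedProd f h := rfl

theorem twistedProdRight_apply (g h : S2 N) : twistedProdRight g h = twistedProd h g := rfl

/-- `T × f`, defined by `⟨T × f, h⟩ = ⟨T, f × h⟩`. -/
def distProd (T : S2' N) (f : S2 N) : S2' N := T.comp (twistedProdLeft f)

/-- `f × T`, defined by `⟨f × T, h⟩ = ⟨T, h × f⟩`. -/
def prodDist (f : S2 N) (T : S2' N) : S2' N := T.comp (twistedProdRight f)

/-- `T ♮ f`, defined by `⟨T ♮ f, h⟩ = ⟨T, f̌ ♮ h⟩`. -/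
def distConv (T : S2' N) (f : S2 N) : S2' N := T.comp (twistedConvLeft (check f))

/-- `f ♮ T`, defined by `⟨f ♮ T, h⟩ = ⟨T, h ♮ f̌⟩`. -/
def convDist (f : S2 N) (T : S2' N) : S2' N := T.comp (twistedConvRight (check f))

/-- The partial derivative `∂_{J 0} ⋯ ∂_{J (n-1)} f` of order `n`. For `f` of class `C^n` the
order of differentiation is irrelevant, so these are the derivatives `∂^α f` with `|α| = n`. -/
def partialDeriv (n : ℕ) (J : Fin n → Fin N ⊕ Fin N) (f : Phase N → ℂ) (u : Phase N) : ℂ :=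
  iteratedFDeriv ℝ n f u fun i => EuclideanSpace.single (J i) (1 : ℝ)

/-- The weight `(1 + u²)^{-k - n/2}`. -/
def weight (k n : ℕ) (u : Phase N) : ℝ := (1 + ‖u‖ ^ 2) ^ (-(k : ℝ) - (n : ℝ) / 2)

theorem weight_pos (k n : ℕ) (u : Phase N) : 0 < weight k n u := by
  unfold weight; positivity

theorem partialDeriv_add {n : ℕ} (J : Fin n → Fin N ⊕ Fin N) {f g : Phase N → ℂ}
    (hf : ContDiff ℝ n f) (hg : ContDiff ℝ n g) (u : Phase N) :
    partialDeriv n J (f + g) u = partialDeriv n J f u + partialDeriv n J g u := by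
  unfold partialDeriv
  rw [iteratedFDeriv_add_apply hf.contDiffAt hg.contDiffAt]
  rfl

theorem partialDeriv_smul {n : ℕ} (J : Fin n → Fin N ⊕ Fin N) {f : Phase N → ℂ}
    (hf : ContDiff ℝ n f) (c : ℂ) (u : Phase N) :
    partialDeriv n J (c • f) u = c * partialDeriv n J f u := by
  unfold partialDeriv
  rw [iteratedFDeriv_const_smul_apply hf.contDiffAt]
  rfl

/-- The space `𝒱_k^m` of the functions `f` of class `C^m` such that `(1 + u²)^{-k-|α|/2} ∂^α f(u)`
vanishes at infinity for all `|α| ≤ m`. -/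
def Vkm (N k m : ℕ) : Submodule ℂ (Phase N → ℂ) where
  carrier := {f | ContDiff ℝ m f ∧ ∀ n ≤ m, ∀ J : Fin n → Fin N ⊕ Fin N,
    Tendsto (fun u => (weight k n u : ℂ) * partialDeriv n J f u) (cocompact (Phase N)) (𝓝 0)}
  zero_mem' := by
    refine ⟨contDiff_const, fun n _ J => ?_⟩
    have : ∀ u, partialDeriv n J (0 : Phase N → ℂ) u = 0 := fun u => by
      simp [partialDeriv]
    simp [this, tendsto_const_nhds]
  add_mem' := by
    rintro f g ⟨hf, hf'⟩ ⟨hg, hg'⟩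
    refine ⟨hf.add hg, fun n hn J => ?_⟩
    have hn' : (n : WithTop ℕ∞) ≤ m := by exact_mod_cast hn
    have := (hf' n hn J).add (hg' n hn J)
    rw [add_zero] at this
    refine this.congr fun u => ?_
    rw [partialDeriv_add J (hf.of_le hn') (hg.of_le hn'), mul_add]
  smul_mem' := by
    rintro c f ⟨hf, hf'⟩
    refine ⟨hf.const_smul c, fun n hn J => ?_⟩
    have hn' : (n : WithTop ℕ∞) ≤ m := by exact_mod_cast hn
    have := (hf' n hn J).const_mul c
    rw [mul_zero] at this
    refine this.congr fun u => ?_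
    rw [partialDeriv_smul J (hf.of_le hn')]
    ring

theorem mem_Vkm {k m : ℕ} {f : Phase N → ℂ} : f ∈ Vkm N k m ↔
    ContDiff ℝ m f ∧ ∀ n ≤ m, ∀ J : Fin n → Fin N ⊕ Fin N,
      Tendsto (fun u => (weight k n u : ℂ) * partialDeriv n J f u)
        (cocompact (Phase N)) (𝓝 0) := Iff.rfl

/-- The points `u` and the multi-indices of order at most `m` over which `p_{k,m}` is a
supremum. -/
abbrev SupIndex (N m : ℕ) : Type :=
  Phase N × (Σ n : Fin (m + 1), (Fin (n : ℕ) → Fin N ⊕ Fin N))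

instance (N m : ℕ) : Nonempty (SupIndex N m) := ⟨(0, ⟨0, fun i => i.elim0⟩)⟩

theorem bddAbove_Vkm {k m : ℕ} {f : Phase N → ℂ} (hf : f ∈ Vkm N k m) :
    BddAbove (Set.range fun i : SupIndex N m =>
      weight k i.2.1 i.1 * ‖partialDeriv i.2.1 i.2.2 f i.1‖) := by
  have key : ∀ j : (Σ n : Fin (m + 1), (Fin (n : ℕ) → Fin N ⊕ Fin N)),
      ∃ C, ∀ u, weight k j.1 u * ‖partialDeriv j.1 j.2 f u‖ ≤ C := by
    rintro ⟨n, J⟩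
    have hn : (n : ℕ) ≤ m := Nat.lt_succ_iff.1 n.2
    have hn' : ((n : ℕ) : WithTop ℕ∞) ≤ m := by exact_mod_cast hn
    have hc1 : Continuous fun u : Phase N => (weight k n u : ℂ) := by
      refine Complex.continuous_ofReal.comp ?_
      unfold weight
      exact Continuous.rpow_const (by fun_prop) fun u => Or.inl (by positivity)
    have hc2 : Continuous fun u => partialDeriv n J f u :=
      (continuous_eval_const (F := Phase N [×(n : ℕ)]→L[ℝ] ℂ) _).comp
        (hf.1.continuous_iteratedFDeriv hn')
    let g : ZeroAtInftyContinuousMap (Phase N) ℂ :=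
      ⟨⟨fun u => (weight k n u : ℂ) * partialDeriv n J f u, hc1.mul hc2⟩, hf.2 n hn J⟩
    obtain ⟨C, hC⟩ := (ZeroAtInftyContinuousMap.isBounded_range g).exists_norm_le
    refine ⟨C, fun u => ?_⟩
    have := hC _ ⟨u, rfl⟩
    change ‖(weight k n u : ℂ) * partialDeriv n J f u‖ ≤ C at this
    rwa [norm_mul, Complex.norm_real, Real.norm_of_nonneg (weight_pos k n u).le] at this
  choose C hC using key
  obtain ⟨M, hM⟩ := (Set.finite_range C).bddAbove
  refine ⟨M, ?_⟩
  rintro _ ⟨⟨u, j⟩, rfl⟩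
  exact (hC j u).trans (hM ⟨j, rfl⟩)

/-- The norm `p_{k,m}(f) = sup {(1 + u²)^{-k-|α|/2} |∂^α f(u)| : u ∈ ℝ^{2N}, |α| ≤ m}`
on `𝒱_k^m`. -/
def pkm (N k m : ℕ) : Seminorm ℂ (Vkm N k m) :=
  Seminorm.of
    (fun f => ⨆ i : SupIndex N m,
      weight k i.2.1 i.1 * ‖partialDeriv i.2.1 i.2.2 (f : Phase N → ℂ) i.1‖)
    (fun f g => by
      refine ciSup_le fun i => ?_
      have hn : ((i.2.1 : ℕ) : WithTop ℕ∞) ≤ m := by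
        exact_mod_cast Nat.lt_succ_iff.1 i.2.1.2
      have h1 := le_ciSup (bddAbove_Vkm f.2) i
      have h2 := le_ciSup (bddAbove_Vkm g.2) i
      have hw := (weight_pos k i.2.1 i.1).le
      calc _ = weight k i.2.1 i.1 * ‖partialDeriv i.2.1 i.2.2 (f : Phase N → ℂ) i.1 +
            partialDeriv i.2.1 i.2.2 (g : Phase N → ℂ) i.1‖ := by
            rw [← partialDeriv_add _ (f.2.1.of_le hn) (g.2.1.of_le hn)]; rfl
        _ ≤ weight k i.2.1 i.1 * (‖partialDeriv i.2.1 i.2.2 (f : Phase N → ℂ) i.1‖ +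
            ‖partialDeriv i.2.1 i.2.2 (g : Phase N → ℂ) i.1‖) := by
            gcongr; exact norm_add_le _ _
        _ ≤ _ := by rw [mul_add]; exact add_le_add h1 h2)
    (fun c f => by
      rw [Real.mul_iSup_of_nonneg (norm_nonneg c)]
      congr 1
      ext i
      have hn : ((i.2.1 : ℕ) : WithTop ℕ∞) ≤ m := by
        exact_mod_cast Nat.lt_succ_iff.1 i.2.1.2
      have : partialDeriv i.2.1 i.2.2 ((c • f : Vkm N k m) : Phase N → ℂ) i.1 =
          c * partialDeriv i.2.1 i.2.2 (f : Phase N → ℂ) i.1 :=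
        partialDeriv_smul _ (f.2.1.of_le hn) c _
      rw [this, norm_mul]
      ring)

theorem pkm_apply {k m : ℕ} (f : Vkm N k m) : pkm N k m f = ⨆ i : SupIndex N m,
    weight k i.2.1 i.1 * ‖partialDeriv i.2.1 i.2.2 (f : Phase N → ℂ) i.1‖ := rfl

/-- The vector space underlying `𝒱_k = ⋂ m, 𝒱_k^m`. -/
def VkSubmodule (N k : ℕ) : Submodule ℂ (Phase N → ℂ) := ⨅ m, Vkm N k m

theorem VkSubmodule_le (N k m : ℕ) : VkSubmodule N k ≤ Vkm N k m := iInf_le _ m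

/-- The space `𝒱_k = ⋂ m, 𝒱_k^m`. -/
def Vk (N k : ℕ) : Type := VkSubmodule N k

instance (N k : ℕ) : AddCommGroup (Vk N k) := inferInstanceAs (AddCommGroup (VkSubmodule N k))

instance (N k : ℕ) : Module ℂ (Vk N k) := inferInstanceAs (Module ℂ (VkSubmodule N k))

/-- The inclusion of `𝒱_k` in `𝒱_k^m`. -/
def Vk.toVkm (N k m : ℕ) : Vk N k →ₗ[ℂ] Vkm N k m :=
  Submodule.inclusion (VkSubmodule_le N k m)

/-- The restrictions to `𝒱_k` of the norms `p_{k,m}`, `m ∈ ℕ`. -/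
def Vk.seminormFamily (N k : ℕ) : SeminormFamily ℂ (Vk N k) ℕ :=
  fun m => (pkm N k m).comp (Vk.toVkm N k m)

/-- The projective topology on `𝒱_k = ⋂ m, 𝒱_k^m`, that is, the locally convex topology generated
by the norms `p_{k,m}`, `m ∈ ℕ`. -/
instance (N k : ℕ) : TopologicalSpace (Vk N k) :=
  (Vk.seminormFamily N k).moduleFilterBasis.topology

theorem Vk.withSeminorms (N k : ℕ) : WithSeminorms (Vk.seminormFamily N k) := ⟨rfl⟩

theorem weight_succ_le (k n : ℕ) (u : Phase N) : weight (k + 1) n u ≤ weight k n u := by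
  unfold weight
  refine Real.rpow_le_rpow_of_exponent_le (by nlinarith [sq_nonneg ‖u‖]) ?_
  push_cast
  linarith

theorem VkSubmodule_mono (N : ℕ) : Monotone (VkSubmodule N) := by
  refine monotone_nat_of_le_succ fun k => le_iInf fun m => ?_
  refine (VkSubmodule_le N k m).trans fun f hf => ⟨hf.1, fun n hn J => ?_⟩
  refine squeeze_zero_norm (fun u => ?_) (tendsto_zero_iff_norm_tendsto_zero.1 (hf.2 n hn J))
  rw [norm_mul, norm_mul, Complex.norm_real, Complex.norm_real,
    Real.norm_of_nonneg (weight_pos _ n u).le, Real.norm_of_nonneg (weight_pos _ n u).le]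
  gcongr
  exact weight_succ_le k n u

/-- The vector space underlying `𝒪_T = ⋃ k, 𝒱_k`. -/
def OTSubmodule (N : ℕ) : Submodule ℂ (Phase N → ℂ) where
  carrier := {f | ∃ k, f ∈ VkSubmodule N k}
  zero_mem' := ⟨0, Submodule.zero_mem _⟩
  add_mem' := by
    rintro f g ⟨k, hk⟩ ⟨l, hl⟩
    exact ⟨max k l, Submodule.add_mem _ (VkSubmodule_mono N (le_max_left k l) hk)
      (VkSubmodule_mono N (le_max_right k l) hl)⟩
  smul_mem' := by
    rintro c f ⟨k, hk⟩
    exact ⟨k, Submodule.smul_mem _ c hk⟩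

/-- The space `𝒪_T = ⋃ k, 𝒱_k`. -/
def OT (N : ℕ) : Type := OTSubmodule N

instance (N : ℕ) : AddCommGroup (OT N) := inferInstanceAs (AddCommGroup (OTSubmodule N))

instance (N : ℕ) : Module ℂ (OT N) := inferInstanceAs (Module ℂ (OTSubmodule N))

/-- The inclusion of `𝒱_k` in `𝒪_T`. -/
def Vk.toOT (N k : ℕ) : Vk N k →ₗ[ℂ] OT N :=
  Submodule.inclusion (p := VkSubmodule N k) (p' := OTSubmodule N) fun _ hf => ⟨k, hf⟩

/-- The function on `ℝ^{2N}` that an element of `𝒪_T` is. -/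
def OT.toFun (N : ℕ) : OT N →ₗ[ℂ] (Phase N → ℂ) := (OTSubmodule N).subtype

instance (N : ℕ) : CoeFun (OT N) fun _ => Phase N → ℂ := ⟨fun f => OT.toFun N f⟩

/-- The locally convex vector space topologies on `𝒪_T` for which all the inclusions
`𝒱_k ⊆ 𝒪_T` are continuous. -/
def OT.topologies (N : ℕ) : Set (TopologicalSpace (OT N)) :=
  {t | @IsTopologicalAddGroup (OT N) t _ ∧ @ContinuousSMul ℂ (OT N) _ _ t ∧
    @LocallyConvexSpace ℝ (OT N) _ _ _ _ t ∧ ∀ k, Continuous[_, t] (Vk.toOT N k)}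

/-- The inductive topology on `𝒪_T = ⋃ k, 𝒱_k`: the strongest locally convex topology such that
all the inclusions `𝒱_k ⊆ 𝒪_T` are continuous. In Mathlib's order, the strongest topology is
the infimum. -/
instance (N : ℕ) : TopologicalSpace (OT N) := sInf (OT.topologies N)

instance (N : ℕ) : IsTopologicalAddGroup (OT N) :=
  topologicalAddGroup_sInf fun _ ht => ht.1

instance (N : ℕ) : ContinuousSMul ℂ (OT N) := continuousSMul_sInf fun _ ht => ht.2.1

instance (N : ℕ) : LocallyConvexSpace ℝ (OT N) := LocallyConvexSpace.sInf fun _ ht => ht.2.2.1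

theorem Vk.continuous_toOT (N k : ℕ) : Continuous (Vk.toOT N k) :=
  continuous_sInf_rng.2 fun _ ht => ht.2.2.2 k

/-- The tempered distribution `T` is the function `g`: `⟨T, h⟩ = ∫ g(u) h(u) du` for all
`h ∈ 𝓢₂`. -/
def IsFunction (T : S2' N) (g : OT N) : Prop := ∀ h : S2 N, T h = ∫ u, g u * h u ∂(dx N)

theorem OT.continuous (g : OT N) : Continuous g := by
  obtain ⟨k, hk⟩ := (g : OTSubmodule N).2
  exact (VkSubmodule_le N k 0 hk).1.continuous

/-- A tempered distribution is at most one element of `𝒪_T`. -/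
theorem IsFunction.unique {T : S2' N} {g₁ g₂ : OT N} (h₁ : IsFunction T g₁)
    (h₂ : IsFunction T g₂) : g₁ = g₂ := by
  have hc : Continuous fun u => g₁ u - g₂ u := (OT.continuous g₁).sub (OT.continuous g₂)
  have hae : (fun u => g₁ u - g₂ u) =ᵐ[dx N] 0 := by
    refine ae_eq_zero_of_integral_contDiff_smul_eq_zero hc.locallyIntegrable fun φ hφ hφc => ?_
    let h : S2 N := (hφc.comp_left (g := ((↑) : ℝ → ℂ)) Complex.ofReal_zero).toSchwartzMap
      (Complex.ofRealCLM.contDiff.comp hφ)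
    have hh : ∀ u, h u = (φ u : ℂ) := fun u => rfl
    have hi : ∀ g : OT N, Integrable (fun u => g u * h u) (dx N) := fun g =>
      ((OT.continuous g).mul h.continuous).integrable_of_hasCompactSupport
        (HasCompactSupport.mul_left (hφc.comp_left (g := ((↑) : ℝ → ℂ)) Complex.ofReal_zero))
    have e := (h₁ h).symm.trans (h₂ h)
    rw [← sub_eq_zero, ← integral_sub (hi g₁) (hi g₂)] at e
    rw [← e]
    congr 1
    ext u
    rw [hh, Complex.real_smul]
    ring
  have hzero := (Continuous.ae_eq_iff_eq (dx N) hc continuous_zero).1 hae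
  refine Subtype.ext (funext fun u => ?_)
  exact sub_eq_zero.1 (congrFun hzero u)

end Moyal

end

open Moyal

/-! Everything reduces to the functions `twistFun σ T f u`, the values of `T` at the twisted
translates `shift σ u f`, that is, at t ↦ f(u - t) exp(iσ u'Jt). Since `T` commutes with integrals
of 𝓢₂-valued functions (`apply_eq_integral`), T ♮ f is this function for σ = 1 and f ♮ T is the one
for σ = -1. The symplectic Fourier transform F turns f × h into Ff ♮ h and h × f into h ♮ (Ff)ˇ, so
the twisted products are twisted convolutions with a transformed f, and F and reflection are
continuous on 𝓢₂.

Membership in 𝒪_T: continuous seminorms of `shift σ u f` grow polynomially in u, so `twistFun σ T f`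
= O((1+|u|)^r) with r depending on T only. Differentiating along e_j gives `twistFun σ T (gen σ j
f)` plus the linear form iσ e_j'Ju times `twistFun σ T f`. Each derivative thus costs one power of
1+|u|, exactly what the factor (1+u²)^{-|α|/2} in the norms of 𝒱_k pays for. A single k therefore
serves all orders of differentiation and all f, and continuity in f follows from estimates in that
one 𝒱_k.

Continuity in T is harder: a strong neighbourhood of 0 contains T of arbitrarily large order, so no
single 𝒱_k suffices. Given a continuous seminorm q on 𝒪_T, cut the function along shells R_K ≤ |u| ≤
2R_{K+1} and measure the K-th piece in 𝒱_K. On that shell it is enough that |T(shift σ u g)| ≤ a_K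
(1+|u|)^{2K} for finitely many g. If R_K grows fast enough, the corresponding multiples of the
`shift σ u g`, over all shells, form one bounded set (`exists_radii`), and its polar is the required
neighbourhood. For each T in it, the part beyond a large radius is small in the 𝒱_k belonging to T
(`exists_remainder_bound`), so finitely many pieces and a remainder give q ≤ 1. -/

noncomputable section

namespace Moyal

variable {N : ℕ}

/-! ### Schwartz seminorms through iterated partial derivatives -/

/-- The unit vectors of phase space. -/
abbrev unitVec (j : Fin N ⊕ Fin N) : Phase N := EuclideanSpace.single j (1 : ℝ)

/-- The partial derivative `∂_j` on `𝓢₂`. -/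
abbrev pderiv (j : Fin N ⊕ Fin N) : S2 N →L[ℂ] S2 N :=
  LineDeriv.lineDerivOpCLM ℂ (S2 N) (unitVec j)

theorem pderiv_apply (j : Fin N ⊕ Fin N) (f : S2 N) (x : Phase N) :
    pderiv j f x = fderiv ℝ f x (unitVec j) := rfl

theorem sum_smul_unitVec (m : Phase N) : m = ∑ j, m j • unitVec j := by
  ext i
  simp only [WithLp.ofLp_sum, Finset.sum_apply, WithLp.ofLp_smul, Pi.smul_apply, smul_eq_mul,
    PiLp.single_apply, mul_ite, mul_one, mul_zero, Finset.sum_ite_eq,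
    Finset.mem_univ, if_true]

/-- The linear map `c ↦ (m ↦ m_j c)`. -/
def coordSMul (j : Fin N ⊕ Fin N) : ℂ →L[ℝ] (Phase N →L[ℝ] ℂ) :=
  ContinuousLinearMap.smulRightL ℝ (Phase N) ℂ (EuclideanSpace.proj j)

theorem coordSMul_apply (j : Fin N ⊕ Fin N) (c : ℂ) (m : Phase N) :
    coordSMul j c m = m j • c := rfl

theorem norm_coordSMul_le (j : Fin N ⊕ Fin N) : ‖coordSMul (N := N) j‖ ≤ 1 := by
  refine ContinuousLinearMap.opNorm_le_bound _ zero_le_one fun c => ?_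
  rw [one_mul]
  refine ContinuousLinearMap.opNorm_le_bound _ (norm_nonneg c) fun m => ?_
  rw [coordSMul_apply, norm_smul, mul_comm]
  gcongr
  exact PiLp.norm_apply_le m j

theorem norm_iteratedFDeriv_sum_coordSMul_le {n : ℕ} {F : Fin N ⊕ Fin N → Phase N → ℂ}
    (hF : ∀ j, ContDiff ℝ n (F j)) (x : Phase N) :
    ‖iteratedFDeriv ℝ n (fun y => ∑ j, coordSMul j (F j y)) x‖ ≤
      ∑ j, ‖iteratedFDeriv ℝ n (F j) x‖ := by
  have hsum : iteratedFDeriv ℝ n (fun y => ∑ j, coordSMul j (F j y)) x =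
      ∑ j, iteratedFDeriv ℝ n (fun y => coordSMul j (F j y)) x :=
    iteratedFDeriv_fun_sum_apply fun j _ => ((coordSMul j).contDiff.comp (hF j)).contDiffAt
  rw [hsum]
  refine (norm_sum_le _ _).trans (Finset.sum_le_sum fun j _ => ?_)
  refine ((coordSMul j).norm_iteratedFDeriv_comp_left (hF j).contDiffAt le_rfl).trans ?_
  exact mul_le_of_le_one_left (norm_nonneg _) (norm_coordSMul_le j)

theorem fderiv_eq_sum_coordSMul (f : S2 N) :
    fderiv ℝ f = fun x => ∑ j, coordSMul j (pderiv j f x) := by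
  ext x m
  conv_lhs => rw [sum_smul_unitVec m]
  simp only [map_sum, map_smul, sum_apply, coordSMul_apply, pderiv_apply]

/-- The total derivative is the sum of the partial derivatives times coordinate forms of norm at
most 1, so no constant appears. This reduces every Schwartz seminorm to the weighted supremum norms.
-/
theorem seminorm_succ_le (k n : ℕ) :
    SchwartzMap.seminorm ℂ k (n + 1) ≤
      ∑ j : Fin N ⊕ Fin N, (SchwartzMap.seminorm ℂ k n).comp (pderiv j).toLinearMap := by
  intro f
  refine SchwartzMap.seminorm_le_bound ℂ k (n + 1) f (apply_nonneg _ _) fun x => ?_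
  rw [← norm_iteratedFDeriv_fderiv, fderiv_eq_sum_coordSMul]
  calc _ ≤ ‖x‖ ^ k * ∑ j, ‖iteratedFDeriv ℝ n (pderiv j f) x‖ := by
        gcongr
        exact norm_iteratedFDeriv_sum_coordSMul_le (fun j => (pderiv j f).smooth n) x
    _ ≤ _ := by
        rw [Finset.mul_sum, sum_apply]
        exact Finset.sum_le_sum fun j _ => SchwartzMap.le_seminorm ℂ k n (pderiv j f) x

/-- A property of seminorms on `𝓢₂` holds for all the continuous ones if it holds for weighted
supremum norms, and passes to sums, to dominated seminorms and to compositions with partial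
derivatives. -/
theorem continuous_seminorm_induction {C : Seminorm ℂ (S2 N) → Prop}
    (sup : ∀ k, C (SchwartzMap.seminorm ℂ k 0))
    (add : ∀ p q, C p → C q → C (p + q))
    (mono : ∀ p q : Seminorm ℂ (S2 N), ∀ c : ℝ≥0, C p → q ≤ c • p → C q)
    (comp : ∀ p j, C p → C (p.comp (pderiv j).toLinearMap))
    {p : Seminorm ℂ (S2 N)} (hp : Continuous p) : C p := by
  have zero : C 0 := mono _ 0 0 (sup 0) (by simp)
  have sum : ∀ {ι : Type} (s : Finset ι) (q : ι → Seminorm ℂ (S2 N)), (∀ i, C (q i)) →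
      C (∑ i ∈ s, q i) := fun s q hq => Finset.sum_induction _ _ add zero fun i _ => hq i
  have all : ∀ n k, C (SchwartzMap.seminorm ℂ k n) := by
    intro n
    induction n with
    | zero => exact sup
    | succ n ih =>
      intro k
      refine mono _ _ 1 (sum Finset.univ _ fun j => comp _ j (ih k)) ?_
      rw [one_smul]
      exact seminorm_succ_le k n
  obtain ⟨s, c, -, h⟩ := Seminorm.bound_of_continuous (schwartz_withSeminorms ℂ (Phase N) ℂ) p hp
  refine mono _ _ c (sum s (schwartzSeminormFamily ℂ (Phase N) ℂ) fun i => all i.2 i.1) ?_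
  refine h.trans fun f => ?_
  rw [smul_apply, smul_apply]
  exact mul_le_mul_of_nonneg_left (Seminorm.finset_sup_le_sum _ s f) c.2

theorem continuous_schwartzSeminorm (k n : ℕ) :
    Continuous (SchwartzMap.seminorm ℂ k n : Seminorm ℂ (S2 N)) :=
  (schwartz_withSeminorms ℂ (Phase N) ℂ).continuous_seminorm (k, n)

/-! ### Twisted translates and their dependence on u -/

/-- The n-th derivative is iⁿ times the function itself, hence bounded. Composed with linear forms,
this makes multiplication by a phase a continuous operator on 𝓢₂. -/
theorem hasTemperateGrowth_cexp_mul_I :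
    (fun x : ℝ => Complex.exp (x * Complex.I)).HasTemperateGrowth := by
  have h : ∀ n : ℕ, iteratedDeriv n (fun x : ℝ => Complex.exp (x * Complex.I)) =
      fun x : ℝ => Complex.I ^ n * Complex.exp (x * Complex.I) := by
    intro n
    induction n with
    | zero => simp
    | succ n ih =>
      rw [iteratedDeriv_succ, ih]
      ext x
      have h1 : HasDerivAt (fun x : ℝ => (x : ℂ) * Complex.I) (1 * Complex.I) x :=
        (Complex.ofRealCLM.hasDerivAt (x := x)).mul_const _
      rw [(h1.cexp.const_mul (Complex.I ^ n)).deriv]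
      ring
  refine ⟨(Complex.ofRealCLM.contDiff.mul contDiff_const).cexp, fun n => ⟨0, 1, fun x => ?_⟩⟩
  rw [norm_iteratedFDeriv_eq_norm_iteratedDeriv, h, norm_mul, norm_pow, Complex.norm_I,
    Complex.norm_exp_ofReal_mul_I]
  simp

/-- The character `t ↦ exp(i σ u'Jt)`. -/
def phase (σ : ℝ) (u t : Phase N) : ℂ := Complex.exp ((σ * symp u t : ℝ) * Complex.I)

theorem hasTemperateGrowth_phase (σ : ℝ) (u : Phase N) : (phase σ u).HasTemperateGrowth :=
  hasTemperateGrowth_cexp_mul_I.comp (σ • sympCLM N u).hasTemperateGrowth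

theorem norm_phase_eq_one (σ : ℝ) (u t : Phase N) : ‖phase σ u t‖ = 1 :=
  Complex.norm_exp_ofReal_mul_I _

/-- The function `t ↦ f(u - t) exp(i σ u'Jt)`. -/
def shift (σ : ℝ) (u : Phase N) : S2 N →L[ℂ] S2 N :=
  (SchwartzMap.smulLeftCLM ℂ (phase σ u)).comp ((SchwartzMap.compSubConstCLM ℂ u).comp check)

theorem shift_apply (σ : ℝ) (u : Phase N) (f : S2 N) (t : Phase N) :
    shift σ u f t = phase σ u t * f (u - t) := by
  change SchwartzMap.smulLeftCLM ℂ (phase σ u) (SchwartzMap.compSubConstCLM ℂ u (check f)) t = _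
  rw [SchwartzMap.smulLeftCLM_apply_apply (hasTemperateGrowth_phase σ u),
    SchwartzMap.compSubConstCLM_apply, check_apply, neg_sub, smul_eq_mul]

theorem hasFDerivAt_phase_right (σ : ℝ) (u t : Phase N) :
    HasFDerivAt (phase σ u) ((σ * Complex.I * phase σ u t) • Complex.ofRealCLM.comp (sympCLM N u))
      t := by
  have h : HasFDerivAt (fun t : Phase N => ((σ * symp u t : ℝ) : ℂ) * Complex.I)
      ((σ * Complex.I) • Complex.ofRealCLM.comp (sympCLM N u)) t := by
    have := ((σ * Complex.I) • Complex.ofRealCLM.comp (sympCLM N u)).hasFDerivAt (x := t)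
    convert! this using 1
    ext u; simp [sympCLM_apply]; ring
  convert! h.cexp using 1
  rw [smul_smul]
  congr 1
  simp only [phase]; ring

theorem hasFDerivAt_phase_left (σ : ℝ) (u t : Phase N) :
    HasFDerivAt (fun u => phase σ u t)
      ((σ * Complex.I * phase σ u t) • Complex.ofRealCLM.comp ((sympCLM N).flip t)) u := by
  have h : HasFDerivAt (fun u : Phase N => ((σ * symp u t : ℝ) : ℂ) * Complex.I)
      ((σ * Complex.I) • Complex.ofRealCLM.comp ((sympCLM N).flip t)) u := by
    have := ((σ * Complex.I) • Complex.ofRealCLM.comp ((sympCLM N).flip t)).hasFDerivAt (x := u)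
    convert! this using 1
    ext u; simp [sympCLM_apply]; ring
  convert! h.cexp using 1
  rw [smul_smul]
  congr 1
  simp only [phase]; ring

/-- Commutation of ∂_j in the variable t with the twisted translation: the phase contributes a
scalar linear in u. It carries the derivative step in the inductions over seminorms. -/
theorem pderiv_shift (σ : ℝ) (u : Phase N) (j : Fin N ⊕ Fin N) (f : S2 N) :
    pderiv j (shift σ u f) =
      (σ * Complex.I * symp u (unitVec j)) • shift σ u f - shift σ u (pderiv j f) := by
  ext t
  rw [pderiv_apply]
  have h1 : HasFDerivAt (fun t => f (u - t)) (-(fderiv ℝ f (u - t))) t := by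
    have := (f.hasFDerivAt (u - t)).comp t ((hasFDerivAt_id t).const_sub u)
    convert! this using 1
    ext m; simp
  have h2 := (hasFDerivAt_phase_right σ u t).mul h1
  have h3 : (shift σ u f : Phase N → ℂ) = fun t => phase σ u t * f (u - t) :=
    funext fun t => shift_apply σ u f t
  rw [h3]
  rw [show fderiv ℝ (fun t => phase σ u t * f (u - t)) t = _ from h2.fderiv]
  simp only [add_apply, sub_apply, smul_apply, smul_eq_mul, shift_apply, pderiv_apply, neg_apply,
    ContinuousLinearMap.comp_apply, Complex.ofRealCLM_apply, sympCLM_apply]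
  ring

theorem norm_unitVec (j : Fin N ⊕ Fin N) : ‖unitVec j‖ = 1 := by simp

theorem abs_symp_unitVec_right_le (u : Phase N) (j : Fin N ⊕ Fin N) :
    |symp u (unitVec j)| ≤ ‖sympCLM N‖ * (1 + ‖u‖) := by
  have := (sympCLM N).le_opNorm₂ u (unitVec j)
  rw [norm_unitVec, mul_one, sympCLM_apply, Real.norm_eq_abs] at this
  exact this.trans (by gcongr; linarith)

theorem abs_symp_unitVec_left_le (u : Phase N) (j : Fin N ⊕ Fin N) :
    |symp (unitVec j) u| ≤ ‖sympCLM N‖ * (1 + ‖u‖) := by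
  rw [symp_swap, abs_neg]
  exact abs_symp_unitVec_right_le u j

/-- The maps `f ↦ f(u - ·) exp(i σ u'J·)` grow at most polynomially in `u`. -/
theorem exists_bound_shift (σ : ℝ) {p : Seminorm ℂ (S2 N)} (hp : Continuous p) :
    ∃ (r : ℕ) (P : Seminorm ℂ (S2 N)), Continuous P ∧
      ∀ u f, p (shift σ u f) ≤ (1 + ‖u‖) ^ r * P f := by
  refine continuous_seminorm_induction (C := fun p => ∃ (r : ℕ) (P : Seminorm ℂ (S2 N)),
    Continuous P ∧ ∀ u f, p (shift σ u f) ≤ (1 + ‖u‖) ^ r * P f) ?_ ?_ ?_ ?_ hp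
  · intro k
    obtain ⟨P, hP, hb⟩ := exists_seminorm_bound (N := N) k
    refine ⟨k, P, hP, fun u f => ?_⟩
    have h0 : 0 ≤ P f := apply_nonneg _ _
    refine SchwartzMap.seminorm_le_bound ℂ k 0 _ (by positivity) fun t => ?_
    rw [norm_iteratedFDeriv_zero, shift_apply, norm_mul, norm_phase_eq_one, one_mul]
    have h3 : ‖t‖ ≤ (1 + ‖u‖) * (1 + ‖u - t‖) := by
      have := norm_sub_le u (u - t)
      rw [sub_sub_cancel] at this
      nlinarith [norm_nonneg (u - t), norm_nonneg u]
    calc ‖t‖ ^ k * ‖f (u - t)‖ ≤ ((1 + ‖u‖) * (1 + ‖u - t‖)) ^ k * ‖f (u - t)‖ := by gcongr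
      _ = (1 + ‖u‖) ^ k * ((1 + ‖u - t‖) ^ k * ‖f (u - t)‖) := by rw [mul_pow]; ring
      _ ≤ _ := by gcongr; exact hb f _
  · rintro p q ⟨r, P, hP, hp⟩ ⟨s, Q, hQ, hq⟩
    refine ⟨max r s, P + Q, hP.add hQ, fun u f => ?_⟩
    have h0 : 0 ≤ P f := apply_nonneg _ _
    have h1 : 0 ≤ Q f := apply_nonneg _ _
    have hu : 1 ≤ 1 + ‖u‖ := by linarith [norm_nonneg u]
    rw [add_apply, add_apply, mul_add]
    refine add_le_add ((hp u f).trans ?_) ((hq u f).trans ?_)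
    · gcongr
      exact le_max_left _ _
    · gcongr
      exact le_max_right _ _
  · rintro p q c ⟨r, P, hP, hp⟩ hq
    refine ⟨r, c • P, hP.const_smul c, fun u f => (hq _).trans ?_⟩
    rw [smul_apply, smul_apply, NNReal.smul_def, NNReal.smul_def, smul_eq_mul, smul_eq_mul,
      mul_left_comm]
    exact mul_le_mul_of_nonneg_left (hp u f) c.2
  · rintro p j ⟨r, P, hP, hp⟩
    set c : ℝ≥0 := ‖σ‖₊ * ‖sympCLM N‖₊ with hc
    -- The additional power of 1+‖u‖ pays for the scalar that the derivative of the phase produces.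
    refine ⟨r + 1, c • P + P.comp (pderiv j).toLinearMap,
      (hP.const_smul c).add (hP.comp (pderiv j).continuous), fun u f => ?_⟩
    change p (pderiv j (shift σ u f)) ≤ (1 + ‖u‖) ^ (r + 1) * (c • P f + P (pderiv j f))
    have h0 : 0 ≤ P f := apply_nonneg _ _
    have h1 : 0 ≤ P (pderiv j f) := apply_nonneg _ _
    have hu : 1 ≤ 1 + ‖u‖ := by linarith [norm_nonneg u]
    have hs := abs_symp_unitVec_right_le u j
    rw [pderiv_shift]
    refine (map_sub_le_add p _ _).trans ?_
    rw [map_smul_eq_mul, mul_add, NNReal.smul_def, smul_eq_mul]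
    refine add_le_add ?_ ?_
    · calc _ = |σ| * |symp u (unitVec j)| * p (shift σ u f) := by
            simp
        _ ≤ |σ| * (‖sympCLM N‖ * (1 + ‖u‖)) * ((1 + ‖u‖) ^ r * P f) := by
            gcongr
            exact hp u f
        _ = _ := by rw [hc]; push_cast; rw [Real.norm_eq_abs]; ring
    · refine (hp u _).trans ?_
      gcongr
      exact Nat.le_succ r

/-- The operator `f ↦ ∂_j f - i σ (e_j'J·) f` on `𝓢₂`. -/
def gen (σ : ℝ) (j : Fin N ⊕ Fin N) : S2 N →L[ℂ] S2 N :=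
  pderiv j + (σ : ℂ) • mulSymp (unitVec j)

theorem gen_apply (σ : ℝ) (j : Fin N ⊕ Fin N) (f : S2 N) (t : Phase N) :
    gen σ j f t = fderiv ℝ f t (unitVec j) - σ * Complex.I * symp (unitVec j) t * f t := by
  change pderiv j f t + (σ : ℂ) * (mulSymp (unitVec j) f t) = _
  rw [mulSymp_apply, pderiv_apply]
  ring

/-- The derivative in direction `e_j` of `u ↦ shift σ u f`. -/
def shiftDeriv (σ : ℝ) (j : Fin N ⊕ Fin N) (u : Phase N) (f : S2 N) : S2 N :=
  shift σ u (gen σ j f) + (σ * Complex.I * symp (unitVec j) u) • shift σ u f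

/-- The phase contributes e_j'Jt = e_j'Ju - e_j'J(u - t). The second term is a function of u - t and
is absorbed into `gen σ j f`; the first is a scalar independent of t. -/
theorem hasFDerivAt_shift_apply (σ : ℝ) (f : S2 N) (u t : Phase N) :
    HasFDerivAt (fun u => shift σ u f t) (∑ j, coordSMul j (shiftDeriv σ j u f t)) u := by
  have h1 : HasFDerivAt (fun u => f (u - t)) (fderiv ℝ f (u - t)) u :=
    (hasFDerivAt_comp_sub t).2 (f.hasFDerivAt (u - t))
  have h2 := (hasFDerivAt_phase_left σ u t).mul h1
  simp only [shift_apply]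
  convert! h2 using 1
  ext m
  conv_rhs => rw [sum_smul_unitVec m]
  simp only [map_sum, map_smul, sum_apply, coordSMul_apply]
  congr 1
  ext j
  congr 1
  simp only [shiftDeriv, add_apply, smul_apply, shift_apply, gen_apply, smul_eq_mul,
    ContinuousLinearMap.comp_apply, Complex.ofRealCLM_apply, ContinuousLinearMap.flip_apply,
    sympCLM_apply, symp_sub_right]
  push_cast
  ring

theorem exists_bound_shiftDeriv (σ : ℝ) {p : Seminorm ℂ (S2 N)} (hp : Continuous p) :
    ∃ (r : ℕ) (P : Seminorm ℂ (S2 N)), Continuous P ∧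
      ∀ u f, ∑ j, p (shiftDeriv σ j u f) ≤ (1 + ‖u‖) ^ r * P f := by
  obtain ⟨r, P, hP, hb⟩ := exists_bound_shift σ hp
  set c : ℝ≥0 := ‖σ‖₊ * ‖sympCLM N‖₊ with hc
  refine ⟨r + 1, ∑ j, (P.comp (gen σ j).toLinearMap + c • P),
    Seminorm.continuous_finsetSum fun j _ => (hP.comp (gen σ j).continuous).add (hP.const_smul c),
    fun u f => ?_⟩
  rw [sum_apply, Finset.mul_sum]
  refine Finset.sum_le_sum fun j _ => ?_
  change _ ≤ (1 + ‖u‖) ^ (r + 1) * (P (gen σ j f) + c • P f)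
  have h0 : 0 ≤ P f := apply_nonneg _ _
  have h1 : 0 ≤ P (gen σ j f) := apply_nonneg _ _
  have hu : 1 ≤ 1 + ‖u‖ := by linarith [norm_nonneg u]
  have hs := abs_symp_unitVec_left_le u j
  refine (map_add_le_add p _ _).trans ?_
  rw [map_smul_eq_mul, mul_add, NNReal.smul_def, smul_eq_mul]
  refine add_le_add ?_ ?_
  · refine (hb u _).trans ?_
    gcongr
    exact Nat.le_succ r
  · calc _ = |σ| * |symp (unitVec j) u| * p (shift σ u f) := by
          simp
      _ ≤ |σ| * (‖sympCLM N‖ * (1 + ‖u‖)) * ((1 + ‖u‖) ^ r * P f) := by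
          gcongr
          exact hb u f
      _ = _ := by rw [hc]; push_cast; rw [Real.norm_eq_abs]; ring

/-- For weighted supremum norms the mean value inequality gives a Lipschitz bound uniform in t; the
commutation relation `pderiv_shift` carries the claim over to derivatives. -/
theorem tendsto_seminorm_shift_sub (σ : ℝ) {p : Seminorm ℂ (S2 N)} (hp : Continuous p)
    (u : Phase N) (f : S2 N) :
    Tendsto (fun v => p (shift σ v f - shift σ u f)) (𝓝 u) (𝓝 0) := by
  refine continuous_seminorm_induction (C := fun p => ∀ f : S2 N,
    Tendsto (fun v => p (shift σ v f - shift σ u f)) (𝓝 u) (𝓝 0)) ?_ ?_ ?_ ?_ hp f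
  · intro k f
    -- On the unit ball around u one has 1+‖w‖ ≤ 2+‖u‖, so `B` bounds the u-derivatives there,
    -- weighted by ‖t‖^k, for all t at once.
    obtain ⟨r, P, -, hb⟩ := exists_bound_shiftDeriv σ (continuous_schwartzSeminorm (N := N) k 0)
    set B : ℝ := (2 + ‖u‖) ^ r * P f with hB
    have hB0 : 0 ≤ B := mul_nonneg (by positivity) (apply_nonneg _ _)
    have key : ∀ w ∈ Metric.ball u 1, ∀ t,
        ‖t‖ ^ k * ‖∑ j, coordSMul j (shiftDeriv σ j w f t)‖ ≤ B := by
      intro w hw t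
      have hw' : ‖w‖ ≤ 1 + ‖u‖ := by
        have h1 := norm_sub_norm_le w u
        have h2 : ‖w - u‖ < 1 := mem_ball_iff_norm.1 hw
        linarith
      calc _ ≤ ‖t‖ ^ k * ∑ j, ‖shiftDeriv σ j w f t‖ := by
            gcongr
            refine (norm_sum_le _ _).trans (Finset.sum_le_sum fun j _ => ?_)
            refine ((coordSMul j).le_opNorm _).trans ?_
            exact mul_le_of_le_one_left (norm_nonneg _) (norm_coordSMul_le j)
        _ ≤ ∑ j, SchwartzMap.seminorm ℂ k 0 (shiftDeriv σ j w f) := by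
            rw [Finset.mul_sum]
            exact Finset.sum_le_sum fun j _ => SchwartzMap.norm_pow_mul_le_seminorm ℂ _ k t
        _ ≤ (1 + ‖w‖) ^ r * P f := hb w f
        _ ≤ B := mul_le_mul_of_nonneg_right
            (pow_le_pow_left₀ (by positivity) (by linarith) r) (apply_nonneg _ _)
    have lip : ∀ᶠ v in 𝓝 u, SchwartzMap.seminorm ℂ k 0 (shift σ v f - shift σ u f) ≤
        B * ‖v - u‖ := by
      filter_upwards [Metric.ball_mem_nhds u one_pos] with v hv
      refine SchwartzMap.seminorm_le_bound ℂ k 0 _ (by positivity) fun t => ?_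
      rw [norm_iteratedFDeriv_zero, sub_apply]
      have hd : ∀ w ∈ Metric.ball u 1, HasFDerivWithinAt
          (fun w => ((‖t‖ ^ k : ℝ)) • shift σ w f t)
          ((‖t‖ ^ k : ℝ) • ∑ j, coordSMul j (shiftDeriv σ j w f t)) (Metric.ball u 1) w :=
        fun w _ => ((hasFDerivAt_shift_apply σ f w t).fun_const_smul _).hasFDerivWithinAt
      have := (convex_ball u 1).norm_image_sub_le_of_norm_hasFDerivWithin_le hd
        (C := B) (fun w hw => by
          rw [norm_smul, Real.norm_of_nonneg (by positivity)]; exact key w hw t)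
        (Metric.mem_ball_self one_pos) hv
      rwa [← smul_sub, norm_smul, Real.norm_of_nonneg (by positivity)] at this
    refine squeeze_zero' (Eventually.of_forall fun v => apply_nonneg _ _) lip ?_
    have : Tendsto (fun v => B * ‖v - u‖) (𝓝 u) (𝓝 (B * ‖u - u‖)) := by
      apply Continuous.tendsto; fun_prop
    simpa using this
  · intro p q hp hq f
    simpa using (hp f).add (hq f)
  · intro p q c hp hq f
    refine squeeze_zero (fun v => apply_nonneg _ _) (fun v => hq _) ?_
    simpa [NNReal.smul_def] using (hp f).const_mul (c : ℝ)
  · intro p j hp f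
    have hcont : Continuous fun v : Phase N => |σ| * |symp (v - u) (unitVec j)| := by
      have : Continuous fun v : Phase N => symp (v - u) (unitVec j) := by
        simp only [← sympCLM_apply]
        fun_prop
      fun_prop
    have hcont' : Continuous fun v : Phase N => |σ| * |symp v (unitVec j)| := by
      have : Continuous fun v : Phase N => symp v (unitVec j) := by
        simp only [← sympCLM_apply]
        fun_prop
      fun_prop
    have hlim := (((hcont'.tendsto u).mul (hp f)).add
      ((hcont.tendsto u).mul_const (p (shift σ u f)))).add (hp (pderiv j f))
    simp only [sub_self, ← sympCLM_apply, map_zero, zero_apply, abs_zero, mul_zero, zero_mul,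
      add_zero] at hlim
    refine squeeze_zero (fun v => apply_nonneg _ _) (fun v => ?_) hlim
    change p (pderiv j (shift σ v f - shift σ u f)) ≤ _
    have e : pderiv j (shift σ v f - shift σ u f) =
        ((σ * Complex.I * symp v (unitVec j)) • (shift σ v f - shift σ u f) +
          (σ * Complex.I * symp (v - u) (unitVec j)) • shift σ u f) -
        (shift σ v (pderiv j f) - shift σ u (pderiv j f)) := by
      rw [map_sub, pderiv_shift, pderiv_shift, symp_sub_left]
      push_cast
      module
    rw [e]
    refine (map_sub_le_add p _ _).trans (add_le_add_left ((map_add_le_add p _ _).trans ?_) _)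
    rw [map_smul_eq_mul, map_smul_eq_mul]
    refine le_of_eq ?_
    simp only [norm_mul, Complex.norm_real, Complex.norm_I, mul_one, Real.norm_eq_abs, sympCLM_apply]

theorem continuous_shift (σ : ℝ) (f : S2 N) : Continuous fun u => shift σ u f := by
  refine continuous_iff_continuousAt.2 fun u => ?_
  refine ((schwartz_withSeminorms ℂ (Phase N) ℂ).tendsto_nhds _ _).2 fun i ε hε => ?_
  have := tendsto_seminorm_shift_sub σ (continuous_schwartzSeminorm (N := N) i.1 i.2) u f
  exact this.eventually_lt_const hε

/-! ### Tempered distributions commute with integrals -/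

section Pettis

open scoped BoundedContinuousFunction

/-- The function `t ↦ ‖t‖ ^ k f(t)`, as a bounded continuous function. -/
def weightedFun (k : ℕ) (f : S2 N) : Phase N →ᵇ ℂ :=
  BoundedContinuousFunction.ofNormedAddCommGroup (fun t => (‖t‖ ^ k : ℝ) • f t)
    ((continuous_norm.pow k).smul f.continuous)
    (SchwartzMap.seminorm ℂ k 0 f) fun t => by
      rw [norm_smul, Real.norm_of_nonneg (by positivity)]
      exact SchwartzMap.norm_pow_mul_le_seminorm ℂ f k t

/-- The continuous linear map `f ↦ ‖·‖ ^ k f`. -/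
def weighted (k : ℕ) : S2 N →L[ℂ] (Phase N →ᵇ ℂ) :=
  SchwartzMap.mkCLMtoNormedSpace (σ := RingHom.id ℂ) (weightedFun k)
    (fun f g => by ext1 t; exact smul_add _ _ _)
    (fun c f => by ext1 t; exact smul_comm (‖t‖ ^ k : ℝ) c (f t))
    ⟨{(k, 0)}, 1, zero_le_one, fun f => by
      rw [one_mul, Finset.sup_singleton]
      exact BoundedContinuousFunction.norm_ofNormedAddCommGroup_le _ (apply_nonneg _ _) _⟩

theorem weighted_apply (k : ℕ) (f : S2 N) (t : Phase N) :
    weighted k f t = (‖t‖ ^ k : ℝ) • f t := rfl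

theorem seminorm_le_norm_weighted (k : ℕ) (f : S2 N) :
    SchwartzMap.seminorm ℂ k 0 f ≤ ‖weighted k f‖ := by
  refine SchwartzMap.seminorm_le_bound ℂ k 0 f (norm_nonneg _) fun t => ?_
  have := (weighted k f).norm_coe_le_norm t
  rwa [weighted_apply, norm_smul, Real.norm_of_nonneg (by positivity),
    ← norm_iteratedFDeriv_zero (𝕜 := ℝ)] at this

variable {X : Type*} [TopologicalSpace X] [MeasurableSpace X] [OpensMeasurableSpace X]
  {μ : Measure X}

/-- Differentiation under the integral sign, dominated by the (0,1) Schwartz seminorm of `Φ x`. It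
allows the pointwise hypothesis on `ψ` to survive the passage to derivatives in `exists_banach_map`.
-/
theorem lineDeriv_eq_integral {Φ : X → S2 N} (hΦ : Continuous Φ)
    (hint : ∀ p : Seminorm ℂ (S2 N), Continuous p → Integrable (fun x => p (Φ x)) μ)
    {ψ : S2 N} (hψ : ∀ t, ψ t = ∫ x, Φ x t ∂μ) (m t : Phase N) :
    (∂_{m} ψ) t = ∫ x, (∂_{m} (Φ x)) t ∂μ := by
  have heval : ∀ t, Continuous fun x => Φ x t := fun t =>
    (BoundedContinuousFunction.evalCLM ℝ t).continuous.comp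
      ((SchwartzMap.toBoundedContinuousFunctionCLM ℂ (Phase N) ℂ).continuous.comp hΦ)
  have hderiv : Continuous fun x => fderiv ℝ (Φ x) t :=
    (BoundedContinuousFunction.evalCLM ℝ t).continuous.comp
      ((SchwartzMap.toBoundedContinuousFunctionCLM ℂ (Phase N) (Phase N →L[ℝ] ℂ)).continuous.comp
        ((SchwartzMap.fderivCLM ℂ (Phase N) ℂ).continuous.comp hΦ))
  have h0 : ∀ t, Integrable (fun x => Φ x t) μ := fun t =>
    (hint _ (continuous_schwartzSeminorm 0 0)).mono' (heval t).aestronglyMeasurable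
      (ae_of_all _ fun x => SchwartzMap.norm_le_seminorm ℂ (Φ x) t)
  have hb : ∀ x s, ‖fderiv ℝ (Φ x) s‖ ≤ SchwartzMap.seminorm ℂ 0 1 (Φ x) := fun x s => by
    have := SchwartzMap.norm_iteratedFDeriv_le_seminorm ℂ (Φ x) 1 s
    rwa [← norm_iteratedFDeriv_fderiv, norm_iteratedFDeriv_zero] at this
  have hi : Integrable (fun x => SchwartzMap.seminorm ℂ 0 1 (Φ x)) μ :=
    hint _ (continuous_schwartzSeminorm 0 1)
  have h1 : Integrable (fun x => fderiv ℝ (Φ x) t) μ :=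
    hi.mono' hderiv.aestronglyMeasurable (ae_of_all _ fun x => hb x t)
  have key : HasFDerivAt ψ (∫ x, fderiv ℝ (Φ x) t ∂μ) t := by
    rw [show (ψ : Phase N → ℂ) = fun t => ∫ x, Φ x t ∂μ from funext hψ]
    exact hasFDerivAt_integral_of_dominated_of_fderiv_le (s := Set.univ) univ_mem
      (Eventually.of_forall fun s => (heval s).aestronglyMeasurable) (h0 t)
      hderiv.aestronglyMeasurable (ae_of_all _ fun x s _ => hb x s) hi
      (ae_of_all _ fun x s _ => (Φ x).hasFDerivAt s)
  rw [SchwartzMap.lineDerivOp_apply_eq_fderiv, key.fderiv, ContinuousLinearMap.integral_apply h1]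
  rfl

variable [SecondCountableTopology X]

theorem integrable_map {B : Type*} [NormedAddCommGroup B] [NormedSpace ℂ B]
    (E : S2 N →L[ℂ] B) {Φ : X → S2 N} (hΦ : Continuous Φ)
    (hint : ∀ p : Seminorm ℂ (S2 N), Continuous p → Integrable (fun x => p (Φ x)) μ) :
    Integrable (fun x => E (Φ x)) μ := by
  have hE : Continuous ((normSeminorm ℂ B).comp E.toLinearMap) := continuous_norm.comp E.continuous
  exact (hint _ hE).mono' (E.continuous.comp hΦ).aestronglyMeasurable (ae_of_all _ fun _ => le_rfl)

/-- A functional dominated by ‖E ·‖ factors through `E` and extends continuously to the closure of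
its range, where it commutes with the Bochner integral. -/
theorem apply_eq_integral_of_norm_le {B : Type*} [NormedAddCommGroup B] [NormedSpace ℂ B]
    [CompleteSpace B] (T : S2' N) (E : S2 N →L[ℂ] B) {c : ℝ} (hc : ∀ f, ‖T f‖ ≤ c * ‖E f‖)
    {Φ : X → S2 N} (hΦ : Continuous Φ)
    (hint : ∀ p : Seminorm ℂ (S2 N), Continuous p → Integrable (fun x => p (Φ x)) μ)
    {ψ : S2 N} (hψ : E ψ = ∫ x, E (Φ x) ∂μ) : T ψ = ∫ x, T (Φ x) ∂μ := by
  let W : Submodule ℂ B := (LinearMap.range E.toLinearMap).topologicalClosure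
  have hW : ∀ f, E f ∈ W := fun f => Submodule.le_topologicalClosure _ ⟨f, rfl⟩
  let e : S2 N →L[ℂ] W := E.codRestrict W hW
  have he : DenseRange e.toLinearMap := by
    intro w
    rw [closure_subtype, ← Set.range_comp]
    exact w.2
  have : CompleteSpace W := (Submodule.isClosed_topologicalClosure _).completeSpace_coe
  have hTe : ∀ f, T.toLinearMap.extendOfNorm e.toLinearMap (e f) = T f := fun f =>
    LinearMap.extendOfNorm_eq he ⟨c, hc⟩ f
  have hei : Integrable (fun x => e (Φ x)) μ := integrable_map e hΦ hint
  have hψe : e ψ = ∫ x, e (Φ x) ∂μ := by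
    refine Subtype.ext ?_
    change E ψ = W.subtypeL (∫ x, e (Φ x) ∂μ)
    rw [← W.subtypeL.integral_comp_comm hei]
    exact hψ
  rw [← hTe ψ, hψe, ← ContinuousLinearMap.integral_comp_comm _ hei]
  simp only [hTe]

theorem weighted_eq_integral (k : ℕ) {Φ : X → S2 N} (hΦ : Continuous Φ)
    (hint : ∀ p : Seminorm ℂ (S2 N), Continuous p → Integrable (fun x => p (Φ x)) μ)
    {ψ : S2 N} (hψ : ∀ t, ψ t = ∫ x, Φ x t ∂μ) :
    weighted k ψ = ∫ x, weighted k (Φ x) ∂μ := by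
  ext t
  let L : (Phase N →ᵇ ℂ) →L[ℝ] ℂ := BoundedContinuousFunction.evalCLM ℝ t
  change L (weighted k ψ) = L (∫ x, weighted k (Φ x) ∂μ)
  rw [← L.integral_comp_comm (integrable_map _ hΦ hint)]
  change (‖t‖ ^ k : ℝ) • ψ t = ∫ x, (‖t‖ ^ k : ℝ) • Φ x t ∂μ
  rw [integral_smul, hψ]

/-- A continuous seminorm is dominated by the norm of a Banach space into which `𝓢₂` maps, in a
way that commutes with integrals. -/
theorem exists_banach_map (μ : Measure X) {p : Seminorm ℂ (S2 N)} (hp : Continuous p) :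
    ∃ (B : Type) (_ : NormedAddCommGroup B) (_ : NormedSpace ℂ B) (_ : CompleteSpace B)
      (E : S2 N →L[ℂ] B) (c : ℝ), (∀ f, p f ≤ c * ‖E f‖) ∧
      ∀ {Φ : X → S2 N}, Continuous Φ →
        (∀ p : Seminorm ℂ (S2 N), Continuous p → Integrable (fun x => p (Φ x)) μ) →
        ∀ {ψ : S2 N}, (∀ t, ψ t = ∫ x, Φ x t ∂μ) → E ψ = ∫ x, E (Φ x) ∂μ := by
  refine continuous_seminorm_induction (C := fun p =>
    ∃ (B : Type) (_ : NormedAddCommGroup B) (_ : NormedSpace ℂ B) (_ : CompleteSpace B)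
      (E : S2 N →L[ℂ] B) (c : ℝ), (∀ f, p f ≤ c * ‖E f‖) ∧
      ∀ {Φ : X → S2 N}, Continuous Φ →
        (∀ p : Seminorm ℂ (S2 N), Continuous p → Integrable (fun x => p (Φ x)) μ) →
        ∀ {ψ : S2 N}, (∀ t, ψ t = ∫ x, Φ x t ∂μ) → E ψ = ∫ x, E (Φ x) ∂μ) ?_ ?_ ?_ ?_ hp
  · intro k
    refine ⟨_, inferInstance, inferInstance, inferInstance, weighted k, 1, fun f => ?_,
      fun hΦ hint _ hψ => weighted_eq_integral k hΦ hint hψ⟩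
    rw [one_mul]
    exact seminorm_le_norm_weighted k f
  · rintro p q ⟨B, _, _, _, E, c, hc, hE⟩ ⟨B', _, _, _, E', c', hc', hE'⟩
    -- Absolute values, because the constants in the induction hypothesis carry no sign condition.
    refine ⟨B × B', inferInstance, inferInstance, inferInstance, E.prod E', |c| + |c'|,
      fun f => ?_, fun {Φ} hΦ hint ψ hψ => ?_⟩
    · rw [add_mul]
      refine add_le_add ((hc f).trans ?_) ((hc' f).trans ?_)
      · exact mul_le_mul (le_abs_self c) (norm_fst_le (E f, E' f)) (norm_nonneg _) (abs_nonneg _)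
      · exact mul_le_mul (le_abs_self c') (norm_snd_le (E f, E' f)) (norm_nonneg _) (abs_nonneg _)
    · change (E ψ, E' ψ) = ∫ x, (E (Φ x), E' (Φ x)) ∂μ
      rw [integral_pair (integrable_map E hΦ hint) (integrable_map E' hΦ hint), hE hΦ hint hψ,
        hE' hΦ hint hψ]
  · rintro p q a ⟨B, _, _, _, E, c, hc, hE⟩ hq
    refine ⟨B, inferInstance, inferInstance, inferInstance, E, a * c, fun f => (hq f).trans ?_, hE⟩
    rw [smul_apply, NNReal.smul_def, smul_eq_mul, mul_assoc]
    exact mul_le_mul_of_nonneg_left (hc f) a.2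
  · rintro p j ⟨B, _, _, _, E, c, hc, hE⟩
    refine ⟨B, inferInstance, inferInstance, inferInstance, E.comp (pderiv j), c,
      fun f => hc _, fun {Φ} hΦ hint ψ hψ => ?_⟩
    -- The induction hypothesis quantifies over all integrands, so it applies to the differentiated
    -- one.
    exact hE (Φ := fun x => pderiv j (Φ x)) ((pderiv j).continuous.comp hΦ)
      (fun q hq => hint (q.comp (pderiv j).toLinearMap) (hq.comp (pderiv j).continuous))
      (lineDeriv_eq_integral hΦ hint hψ _)

/-- A tempered distribution commutes with integrals of `𝓢₂`-valued functions. -/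
theorem apply_eq_integral (T : S2' N) {Φ : X → S2 N} (hΦ : Continuous Φ)
    (hint : ∀ p : Seminorm ℂ (S2 N), Continuous p → Integrable (fun x => p (Φ x)) μ)
    {ψ : S2 N} (hψ : ∀ t, ψ t = ∫ x, Φ x t ∂μ) : T ψ = ∫ x, T (Φ x) ∂μ := by
  have hT : Continuous ((normSeminorm ℂ ℂ).comp T.toLinearMap) := continuous_norm.comp T.continuous
  obtain ⟨B, _, _, _, E, c, hc, hE⟩ := exists_banach_map μ hT
  exact apply_eq_integral_of_norm_le T E hc hΦ hint (hE hΦ hint hψ)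

end Pettis

/-! ### The twisted convolutions as functions -/

/-- The function `u ↦ ⟨T, f(u - ·) exp(i σ u'J·)⟩`. -/
def twistFun (σ : ℝ) (T : S2' N) (f : S2 N) (u : Phase N) : ℂ := T (shift σ u f)

theorem continuous_twistFun (σ : ℝ) (T : S2' N) (f : S2 N) : Continuous (twistFun σ T f) :=
  T.continuous.comp (continuous_shift σ f)

theorem integrable_pow_one_add_mul (h : S2 N) (r : ℕ) :
    Integrable (fun u => (1 + ‖u‖) ^ r * ‖h u‖) (dx N) := by
  have hi : Integrable (fun u => 2 ^ (r - 1) * (‖h u‖ + ‖u‖ ^ r * ‖h u‖)) (dx N) :=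
    (h.integrable.norm.add (h.integrable_pow_mul (dx N) r)).const_mul _
  have hc : Continuous fun u => (1 + ‖u‖) ^ r * ‖h u‖ := by
    have := h.continuous
    fun_prop
  refine hi.mono' hc.aestronglyMeasurable (ae_of_all _ fun u => ?_)
  rw [Real.norm_of_nonneg (by positivity)]
  calc _ ≤ (2 ^ (r - 1) * (1 ^ r + ‖u‖ ^ r)) * ‖h u‖ := by
        gcongr
        exact add_pow_le zero_le_one (norm_nonneg u) r
    _ = _ := by rw [one_pow]; ring

/-- Integration of `u ↦ f(u - ·) exp(i σ u'J·)` against a Schwartz function commutes with tempered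
distributions. -/
theorem apply_eq_integral_twistFun (σ : ℝ) (T : S2' N) (f h : S2 N) {ψ : S2 N}
    (hψ : ∀ t, ψ t = ∫ u, h u * shift σ u f t ∂(dx N)) :
    T ψ = ∫ u, twistFun σ T f u * h u ∂(dx N) := by
  rw [apply_eq_integral (μ := dx N) T (Φ := fun u => h u • shift σ u f)
    (h.continuous.smul (continuous_shift σ f)) (fun p hp => ?_) hψ]
  · congr 1
    ext u
    rw [map_smul, smul_eq_mul, mul_comm]
    rfl
  · obtain ⟨r, P, -, hP⟩ := exists_bound_shift σ hp
    refine ((integrable_pow_one_add_mul h r).mul_const (P f)).mono'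
      (hp.comp (h.continuous.smul (continuous_shift σ f))).aestronglyMeasurable
      (ae_of_all _ fun u => ?_)
    rw [Real.norm_of_nonneg (apply_nonneg _ _), map_smul_eq_mul]
    calc _ ≤ ‖h u‖ * ((1 + ‖u‖) ^ r * P f) := by gcongr; exact hP u f
      _ = _ := by ring

theorem distConv_apply_eq_integral (T : S2' N) (f h : S2 N) :
    distConv T f h = ∫ u, twistFun 1 T f u * h u ∂(dx N) := by
  change T (twistedConv (check f) h) = _
  refine apply_eq_integral_twistFun 1 T f h fun t => ?_
  rw [twistedConv_apply]
  congr 1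
  ext u
  rw [shift_apply, check_apply, neg_sub, symp_swap t u, phase, one_mul]
  push_cast
  rw [mul_neg, neg_neg, mul_comm Complex.I]
  ring

/-- After the substitution u ↦ t - u in the twisted convolution the phase is -t'J(t - u) = t'Ju =
-u'Jt, which explains the sign σ = -1. -/
theorem convDist_apply_eq_integral (T : S2' N) (f h : S2 N) :
    convDist f T h = ∫ u, twistFun (-1) T f u * h u ∂(dx N) := by
  change T (twistedConv h (check f)) = _
  refine apply_eq_integral_twistFun (-1) T f h fun t => ?_
  rw [twistedConv_apply, ← integral_sub_left_eq_self _ (dx N) t]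
  congr 1
  ext u
  rw [shift_apply, check_apply, neg_sub, sub_sub_cancel, symp_sub_right, symp_self, zero_sub,
    symp_swap t u, phase, neg_one_mul, neg_neg]
  push_cast
  rw [neg_mul, mul_comm Complex.I]
  ring

/-! ### Smoothness of `twistFun` -/

/-- The derivative of `twistFun σ T f`. -/
def twistFunDeriv (σ : ℝ) (T : S2' N) (f : S2 N) (u : Phase N) : Phase N →L[ℝ] ℂ :=
  ∑ j, coordSMul j (T (shiftDeriv σ j u f))

theorem continuous_shiftDeriv (σ : ℝ) (j : Fin N ⊕ Fin N) (f : S2 N) :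
    Continuous fun u => shiftDeriv σ j u f := by
  have h1 := continuous_shift σ (gen σ j f)
  have h2 := continuous_shift σ f
  have h3 : Continuous fun u => symp (unitVec j) u := (sympCLM N (unitVec j)).continuous
  unfold shiftDeriv
  fun_prop

theorem continuous_twistFunDeriv (σ : ℝ) (T : S2' N) (f : S2 N) :
    Continuous (twistFunDeriv σ T f) :=
  continuous_finsetSum _ fun j _ =>
    (coordSMul j).continuous.comp (T.continuous.comp (continuous_shiftDeriv σ j f))

/-- The fundamental theorem of calculus along the segment, first for each value of the twisted
translate at t, then with `T` moved under the integral. No differentiability of u ↦ `shift σ u f` in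
the topology of 𝓢₂ is required. -/
theorem twistFun_add_sub (σ : ℝ) (T : S2' N) (f : S2 N) (u m : Phase N) :
    twistFun σ T f (u + m) - twistFun σ T f u =
      ∫ s in Set.Ioc (0 : ℝ) 1, twistFunDeriv σ T f (u + s • m) m := by
  set Φ : ℝ → S2 N := fun s => ∑ j, (m j : ℂ) • shiftDeriv σ j (u + s • m) f with hΦdef
  have hΦ : Continuous Φ := continuous_finsetSum _ fun j _ =>
    ((continuous_shiftDeriv σ j f).comp (by fun_prop : Continuous fun s : ℝ => u + s • m)).fun_const_smul _
  have hΦapp : ∀ s t, Φ s t = (∑ j, coordSMul j (shiftDeriv σ j (u + s • m) f t)) m := by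
    intro s t
    simp only [hΦdef, sum_apply, smul_apply, coordSMul_apply, smul_eq_mul, Complex.real_smul]
  have key := apply_eq_integral (μ := volume.restrict (Set.Ioc (0 : ℝ) 1)) T hΦ
    (fun p hp => ((hp.comp hΦ).integrableOn_Icc).mono_set Set.Ioc_subset_Icc_self)
    (ψ := shift σ (u + m) f - shift σ u f) (fun t => ?_)
  · rw [map_sub] at key
    refine key.trans (integral_congr_ae (ae_of_all _ fun s => ?_))
    simp only [hΦdef, twistFunDeriv, sum_apply, coordSMul_apply, map_sum, map_smul, smul_eq_mul,
      Complex.real_smul]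
  · have hd : ∀ s : ℝ, HasDerivAt (fun s : ℝ => shift σ (u + s • m) f t) (Φ s t) s := by
      intro s
      have h1 : HasDerivAt (fun s : ℝ => u + s • m) m s := by
        simpa using ((hasDerivAt_id s).smul_const m).const_add u
      rw [hΦapp]
      exact (hasFDerivAt_shift_apply σ f (u + s • m) t).comp_hasDerivAt s h1
    have hc : Continuous fun s => Φ s t :=
      (BoundedContinuousFunction.evalCLM ℝ t).continuous.comp
        ((SchwartzMap.toBoundedContinuousFunctionCLM ℂ (Phase N) ℂ).continuous.comp hΦ)
    have := intervalIntegral.integral_eq_sub_of_hasDerivAt (a := 0) (b := 1)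
      (fun s _ => hd s) (hc.intervalIntegrable 0 1)
    rw [intervalIntegral.integral_of_le zero_le_one] at this
    rw [this, sub_apply]
    simp

/-- The increment is the average of the candidate derivative over the segment, and the candidate is
continuous; near u the error is therefore at most ε‖m‖. -/
theorem hasFDerivAt_twistFun (σ : ℝ) (T : S2' N) (f : S2 N) (u : Phase N) :
    HasFDerivAt (twistFun σ T f) (twistFunDeriv σ T f u) u := by
  rw [hasFDerivAt_iff_isLittleO_nhds_zero, Asymptotics.isLittleO_iff]
  intro ε hε
  obtain ⟨δ, hδ, h⟩ := Metric.continuousAt_iff.1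
    ((continuous_twistFunDeriv σ T f).continuousAt (x := u)) ε hε
  filter_upwards [Metric.ball_mem_nhds (0 : Phase N) hδ] with m hm
  have hi : IntegrableOn (fun s : ℝ => twistFunDeriv σ T f (u + s • m) m) (Set.Ioc 0 1) := by
    have : Continuous fun s : ℝ => twistFunDeriv σ T f (u + s • m) m :=
      ((continuous_twistFunDeriv σ T f).comp (by fun_prop)).clm_apply continuous_const
    exact this.integrableOn_Icc.mono_set Set.Ioc_subset_Icc_self
  have hconst : twistFunDeriv σ T f u m =
      ∫ _ in Set.Ioc (0 : ℝ) 1, twistFunDeriv σ T f u m := by simp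
  rw [twistFun_add_sub, hconst, ← integral_sub hi (by simp)]
  refine (norm_setIntegral_le_of_norm_le_const (C := ε * ‖m‖) (by simp) fun s hs => ?_).trans
    (by simp)
  rw [← sub_apply]
  refine (ContinuousLinearMap.le_opNorm _ _).trans ?_
  gcongr
  rw [← dist_eq_norm]
  refine (h ?_).le
  rw [dist_eq_norm, add_sub_cancel_left, norm_smul, Real.norm_of_nonneg hs.1.le]
  rw [mem_ball_zero_iff] at hm
  exact (mul_le_of_le_one_left (norm_nonneg m) hs.2).trans_lt hm

/-- The linear form `u ↦ i σ e_j'Ju`. -/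
def coordSymp (σ : ℝ) (j : Fin N ⊕ Fin N) : Phase N →L[ℝ] ℂ :=
  (σ * Complex.I) • Complex.ofRealCLM.comp (sympCLM N (unitVec j))

theorem fderiv_twistFun (σ : ℝ) (T : S2' N) (f : S2 N) :
    fderiv ℝ (twistFun σ T f) = fun u => ∑ j, coordSMul j
      (twistFun σ T (gen σ j f) u + coordSymp σ j u * twistFun σ T f u) := by
  ext1 u
  rw [(hasFDerivAt_twistFun σ T f u).fderiv]
  refine Finset.sum_congr rfl fun j _ => ?_
  rw [shiftDeriv, map_add, map_smul]
  rfl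

theorem contDiff_twistFun (σ : ℝ) (T : S2' N) (n : ℕ) :
    ∀ f, ContDiff ℝ n (twistFun σ T f) := by
  induction n with
  | zero => exact fun f => contDiff_zero.2 (continuous_twistFun σ T f)
  | succ n ih =>
    intro f
    push_cast
    refine contDiff_succ_iff_fderiv.2
      ⟨fun u => (hasFDerivAt_twistFun σ T f u).differentiableAt, by simp, ?_⟩
    rw [fderiv_twistFun]
    exact ContDiff.sum fun j _ => (coordSMul j).contDiff.comp
      ((ih _).add ((coordSymp σ j).contDiff.mul (ih _)))

theorem norm_iteratedFDeriv_clm_le (L : Phase N →L[ℝ] ℂ) (n : ℕ) (u : Phase N) :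
    ‖iteratedFDeriv ℝ n L u‖ ≤ ‖L‖ * (1 + ‖u‖) := by
  have hL : 0 ≤ ‖L‖ := norm_nonneg L
  rcases n with _ | _ | n
  · rw [norm_iteratedFDeriv_zero]
    refine (L.le_opNorm u).trans ?_
    gcongr
    linarith
  · rw [zero_add, norm_iteratedFDeriv_one, L.fderiv]
    nlinarith [norm_nonneg u]
  · rw [← norm_iteratedFDeriv_fderiv, show fderiv ℝ L = fun _ => L from funext fun _ => L.fderiv,
      iteratedFDeriv_const_of_ne (Nat.succ_ne_zero n)]
    simp only [Pi.zero_apply, norm_zero]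
    positivity

theorem norm_coordSymp_le (σ : ℝ) (j : Fin N ⊕ Fin N) :
    ‖coordSymp σ j‖ ≤ |σ| * ‖sympCLM N‖ := by
  rw [coordSymp, norm_smul, norm_mul, Complex.norm_real, Complex.norm_I, mul_one, Real.norm_eq_abs]
  gcongr
  refine (ContinuousLinearMap.opNorm_comp_le _ _).trans ?_
  rw [Complex.ofRealCLM_norm, one_mul]
  refine ((sympCLM N).le_opNorm _).trans ?_
  rw [norm_unitVec, mul_one]

/-! ### Derivatives controlled by values -/

/-- The sum of the values of `a` at the images of `f` under the products of at most `n` of the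
operators `gen σ j`, with multiplicities. -/
def genSum (σ : ℝ) : ℕ → (S2 N → ℝ) → S2 N → ℝ
  | 0, a => a
  | n + 1, a => fun f => genSum σ n a f + ∑ j, genSum σ n a (gen σ j f)

/-- The images of `f` under the products of at most `n` of the operators `gen σ j`. -/
def genWords (σ : ℝ) : ℕ → S2 N → Set (S2 N)
  | 0, f => {f}
  | n + 1, f => genWords σ n f ∪ ⋃ j, genWords σ n (gen σ j f)

theorem finite_genWords (σ : ℝ) (n : ℕ) : ∀ f : S2 N, (genWords σ n f).Finite := by
  induction n with
  | zero => exact fun f => Set.finite_singleton f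
  | succ n ih => exact fun f => (ih f).union (Set.finite_iUnion fun j => ih _)

theorem genSum_nonneg {σ : ℝ} {a : S2 N → ℝ} (ha : ∀ f, 0 ≤ a f) (n : ℕ) :
    ∀ f, 0 ≤ genSum σ n a f := by
  induction n with
  | zero => exact ha
  | succ n ih => exact fun f => add_nonneg (ih f) (Finset.sum_nonneg fun j _ => ih _)

theorem monotone_genSum {σ : ℝ} {a : S2 N → ℝ} (ha : ∀ f, 0 ≤ a f) (f : S2 N) :
    Monotone fun n => genSum σ n a f :=
  monotone_nat_of_le_succ fun n => le_add_of_nonneg_right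
    (Finset.sum_nonneg fun _ _ => genSum_nonneg ha n _)

theorem genSum_mono {σ : ℝ} {a b : S2 N → ℝ} {c : ℝ} (h : ∀ f, a f ≤ c * b f) (n : ℕ) :
    ∀ f, genSum σ n a f ≤ c * genSum σ n b f := by
  induction n with
  | zero => exact h
  | succ n ih =>
    intro f
    change _ ≤ c * (genSum σ n b f + ∑ j, genSum σ n b (gen σ j f))
    rw [mul_add, Finset.mul_sum]
    exact add_le_add (ih f) (Finset.sum_le_sum fun j _ => ih _)

theorem genSum_le_of_genWords {σ : ℝ} {a : S2 N → ℝ} {c : ℝ} (n : ℕ) :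
    ∀ f, (∀ g ∈ genWords σ n f, a g ≤ c) →
      genSum σ n a f ≤ (1 + Fintype.card (Fin N ⊕ Fin N) : ℝ) ^ n * c := by
  induction n with
  | zero => intro f h; simpa [genSum] using h f rfl
  | succ n ih =>
    intro f h
    calc genSum σ n a f + ∑ j, genSum σ n a (gen σ j f)
        ≤ (1 + Fintype.card (Fin N ⊕ Fin N) : ℝ) ^ n * c +
          ∑ _j : Fin N ⊕ Fin N, (1 + Fintype.card (Fin N ⊕ Fin N) : ℝ) ^ n * c := by
          refine add_le_add (ih f fun g hg => h g (Or.inl hg)) (Finset.sum_le_sum fun j _ =>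
            ih _ fun g hg => h g (Or.inr (Set.mem_iUnion.2 ⟨j, hg⟩)))
      _ = _ := by rw [Finset.sum_const, Finset.card_univ, nsmul_eq_mul]; ring

theorem exists_seminorm_eq_genSum (σ : ℝ) (n : ℕ) : ∀ {P : Seminorm ℂ (S2 N)}, Continuous P →
    ∃ Q : Seminorm ℂ (S2 N), Continuous Q ∧ ∀ f, genSum σ n P f = Q f := by
  induction n with
  | zero => exact fun {P} hP => ⟨P, hP, fun f => rfl⟩
  | succ n ih =>
    intro P hP
    obtain ⟨Q, hQ, h⟩ := ih hP
    refine ⟨Q + ∑ j, Q.comp (gen σ j).toLinearMap, hQ.add (Seminorm.continuous_finsetSum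
      fun j _ => hQ.comp (gen σ j).continuous), fun f => ?_⟩
    rw [add_apply, sum_apply]
    change genSum σ n P f + ∑ j, genSum σ n P (gen σ j f) = _
    simp only [h]
    rfl

/-- By `fderiv_twistFun`, a derivative either replaces f by `gen σ j f` or multiplies by a linear
form, at the cost of one factor 1+‖u‖. One constant is carried for all orders up to n, since
Leibniz' rule brings back every lower order. -/
theorem exists_bound_iteratedFDeriv_twistFun_aux (N : ℕ) (σ : ℝ) (n : ℕ) :
    ∃ C : ℝ, 0 ≤ C ∧ ∀ k ≤ n, ∀ (T : S2' N) (f : S2 N) (u : Phase N),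
      ‖iteratedFDeriv ℝ k (twistFun σ T f) u‖ ≤
        C * (1 + ‖u‖) ^ k * genSum σ k (fun g => ‖twistFun σ T g u‖) f := by
  induction n with
  | zero =>
    refine ⟨1, zero_le_one, fun k hk T f u => ?_⟩
    obtain rfl : k = 0 := Nat.le_zero.1 hk
    rw [norm_iteratedFDeriv_zero]
    simp [genSum]
  | succ n ih =>
    obtain ⟨C, hC, h⟩ := ih
    set D : ℝ := |σ| * ‖sympCLM N‖ with hD
    have hD0 : 0 ≤ D := by positivity
    set d : ℝ := ((Fintype.card (Fin N ⊕ Fin N) : ℕ) : ℝ) with hd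
    -- The 1 accounts for the terms with `gen σ j f`; d counts the directions, 2^n is the sum of the
    -- binomial coefficients, and D bounds the norm of the linear forms.
    refine ⟨C * (1 + d * (2 ^ n * D)), by positivity, fun k hk T f u => ?_⟩
    have hgs : ∀ k f, 0 ≤ genSum σ k (fun g => ‖twistFun σ T g u‖) f :=
      fun k f => genSum_nonneg (fun g => norm_nonneg _) k f
    have hu : 1 ≤ 1 + ‖u‖ := by linarith [norm_nonneg u]
    rcases Nat.le_succ_iff.1 hk with hk | rfl
    · refine (h k hk T f u).trans ?_
      have := hgs k f
      gcongr
      nlinarith [show 0 ≤ d * (2 ^ n * D) by positivity]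
    set a : S2 N → ℝ := genSum σ n (fun g => ‖twistFun σ T g u‖) with ha
    have hmul : ∀ j, ‖iteratedFDeriv ℝ n (fun u => coordSymp σ j u * twistFun σ T f u) u‖ ≤
        2 ^ n * D * C * (1 + ‖u‖) ^ (n + 1) * a f := by
      intro j
      refine (norm_iteratedFDeriv_mul_le (coordSymp σ j).contDiff (contDiff_twistFun σ T n f) u
        le_rfl).trans ?_
      have hterm : ∀ i ∈ Finset.range (n + 1),
          (n.choose i : ℝ) * ‖iteratedFDeriv ℝ i (coordSymp σ j) u‖ *
            ‖iteratedFDeriv ℝ (n - i) (twistFun σ T f) u‖ ≤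
          (n.choose i : ℝ) * (D * C * (1 + ‖u‖) ^ (n + 1) * a f) := by
        intro i _
        rw [mul_assoc]
        refine mul_le_mul_of_nonneg_left ?_ (by positivity)
        have h1 : ‖iteratedFDeriv ℝ i (coordSymp σ j) u‖ ≤ D * (1 + ‖u‖) :=
          (norm_iteratedFDeriv_clm_le _ i u).trans (by gcongr; exact norm_coordSymp_le σ j)
        have h2 : ‖iteratedFDeriv ℝ (n - i) (twistFun σ T f) u‖ ≤ C * (1 + ‖u‖) ^ n * a f := by
          refine (h (n - i) (Nat.sub_le n i) T f u).trans ?_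
          have h3 := monotone_genSum (σ := σ) (a := fun g => ‖twistFun σ T g u‖)
            (fun g => norm_nonneg _) f (Nat.sub_le n i)
          have h4 : (1 + ‖u‖) ^ (n - i) ≤ (1 + ‖u‖) ^ n := pow_le_pow_right₀ hu (Nat.sub_le n i)
          exact mul_le_mul (by gcongr) h3 (hgs _ _) (by positivity)
        calc _ ≤ D * (1 + ‖u‖) * (C * (1 + ‖u‖) ^ n * a f) := by gcongr
          _ = _ := by ring
      refine (Finset.sum_le_sum hterm).trans (le_of_eq ?_)
      rw [← Finset.sum_mul, ← Nat.cast_sum, Nat.sum_range_choose]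
      push_cast
      ring
    have hcd : ∀ j, ContDiff ℝ n (fun u => coordSymp σ j u * twistFun σ T f u) := fun j =>
      (coordSymp σ j).contDiff.mul (contDiff_twistFun σ T n f)
    rw [← norm_iteratedFDeriv_fderiv, fderiv_twistFun]
    refine (norm_iteratedFDeriv_sum_coordSMul_le
      (fun j => (contDiff_twistFun σ T n _).add (hcd j)) u).trans ?_
    have hj : ∀ j, ‖iteratedFDeriv ℝ n (fun u => twistFun σ T (gen σ j f) u +
        coordSymp σ j u * twistFun σ T f u) u‖ ≤
        C * (1 + ‖u‖) ^ (n + 1) * a (gen σ j f) +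
          2 ^ n * D * C * (1 + ‖u‖) ^ (n + 1) * a f := by
      intro j
      have e : iteratedFDeriv ℝ n (fun u => twistFun σ T (gen σ j f) u +
          coordSymp σ j u * twistFun σ T f u) u = iteratedFDeriv ℝ n (twistFun σ T (gen σ j f)) u +
          iteratedFDeriv ℝ n (fun u => coordSymp σ j u * twistFun σ T f u) u :=
        iteratedFDeriv_add_apply (contDiff_twistFun σ T n _).contDiffAt (hcd j).contDiffAt
      rw [e]
      refine (norm_add_le _ _).trans (add_le_add ((h n le_rfl T _ u).trans ?_) (hmul j))
      have h4 : (1 + ‖u‖) ^ n ≤ (1 + ‖u‖) ^ (n + 1) := pow_le_pow_right₀ hu (Nat.le_succ n)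
      exact mul_le_mul_of_nonneg_right (by gcongr) (hgs _ _)
    refine (Finset.sum_le_sum fun j _ => hj j).trans ?_
    rw [Finset.sum_add_distrib, Finset.sum_const, Finset.card_univ, nsmul_eq_mul, ← Finset.mul_sum]
    change _ ≤ C * (1 + d * (2 ^ n * D)) * (1 + ‖u‖) ^ (n + 1) * (a f + ∑ j, a (gen σ j f))
    have e1 : 0 ≤ a f := hgs n f
    have e2 : 0 ≤ ∑ j, a (gen σ j f) := Finset.sum_nonneg fun j _ => hgs n _
    have e3 : 0 ≤ C * (1 + ‖u‖) ^ (n + 1) := by positivity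
    have e4 : 0 ≤ d * (2 ^ n * D) := by positivity
    rw [← hd]
    calc _ = C * (1 + ‖u‖) ^ (n + 1) * (∑ j, a (gen σ j f) + d * (2 ^ n * D) * a f) := by ring
      _ ≤ C * (1 + ‖u‖) ^ (n + 1) * ((1 + d * (2 ^ n * D)) * (a f + ∑ j, a (gen σ j f))) := by
          gcongr
          nlinarith [mul_nonneg e4 e2]
      _ = _ := by ring

/-- The derivatives of order `n` of `twistFun σ T f` are controlled by the values of the functions
`twistFun σ T g`, for finitely many `g`. -/
theorem exists_bound_iteratedFDeriv_twistFun (N : ℕ) (σ : ℝ) (n : ℕ) :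
    ∃ C : ℝ, 0 ≤ C ∧ ∀ (T : S2' N) (f : S2 N) (u : Phase N),
      ‖iteratedFDeriv ℝ n (twistFun σ T f) u‖ ≤
        C * (1 + ‖u‖) ^ n * genSum σ n (fun g => ‖twistFun σ T g u‖) f := by
  obtain ⟨C, hC, h⟩ := exists_bound_iteratedFDeriv_twistFun_aux N σ n
  exact ⟨C, hC, h n le_rfl⟩

/-! ### Growth estimates and the spaces 𝒱_k -/

/-- From (1+‖u‖)² ≤ 2(1+‖u‖²). Both sides are squared to avoid half-integral exponents. -/
theorem weight_mul_le (k n : ℕ) (u : Phase N) :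
    weight k n u * (1 + ‖u‖) ^ (2 * k + n) ≤ 2 ^ (k + n) := by
  have h1 : 0 < 1 + ‖u‖ ^ 2 := by positivity
  have hw : weight k n u ^ 2 = ((1 + ‖u‖ ^ 2) ^ (2 * k + n))⁻¹ := by
    unfold weight
    generalize 1 + ‖u‖ ^ 2 = y at h1
    rw [← Real.rpow_natCast _ 2, ← Real.rpow_mul h1.le, ← Real.rpow_natCast, ← Real.rpow_neg h1.le]
    congr 1
    push_cast
    ring
  have h2 : (1 + ‖u‖) ^ 2 ≤ 2 * (1 + ‖u‖ ^ 2) := by nlinarith [sq_nonneg (1 - ‖u‖)]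
  refine le_of_sq_le_sq ?_ (by positivity)
  calc (weight k n u * (1 + ‖u‖) ^ (2 * k + n)) ^ 2
      = ((1 + ‖u‖ ^ 2) ^ (2 * k + n))⁻¹ * ((1 + ‖u‖) ^ 2) ^ (2 * k + n) := by
        rw [mul_pow, hw, ← pow_mul, ← pow_mul, mul_comm (2 * k + n) 2]
    _ ≤ ((1 + ‖u‖ ^ 2) ^ (2 * k + n))⁻¹ * (2 * (1 + ‖u‖ ^ 2)) ^ (2 * k + n) := by gcongr
    _ = 2 ^ (2 * k + n) := by rw [mul_pow]; field_simp
    _ ≤ 2 ^ (2 * (k + n)) := pow_le_pow_right₀ one_le_two (by omega)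
    _ = (2 ^ (k + n)) ^ 2 := by rw [← pow_mul, mul_comm]

theorem norm_partialDeriv_le (n : ℕ) (J : Fin n → Fin N ⊕ Fin N) (F : Phase N → ℂ) (u : Phase N) :
    ‖partialDeriv n J F u‖ ≤ ‖iteratedFDeriv ℝ n F u‖ := by
  refine (ContinuousMultilinearMap.le_opNorm _ _).trans ?_
  simp

theorem norm_weight_mul_partialDeriv_le (k n : ℕ) (J : Fin n → Fin N ⊕ Fin N) (F : Phase N → ℂ)
    (u : Phase N) : ‖(weight k n u : ℂ) * partialDeriv n J F u‖ ≤
      weight k n u * ‖iteratedFDeriv ℝ n F u‖ := by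
  rw [norm_mul, Complex.norm_real, Real.norm_of_nonneg (weight_pos k n u).le]
  exact mul_le_mul_of_nonneg_left (norm_partialDeriv_le n J F u) (weight_pos k n u).le

/-- The weight compensates 2k + n powers while only r + n are present. The spare power yields decay,
hence vanishing at infinity in `mem_VkSubmodule_of_bound` and small remainders later. -/
theorem weight_mul_le_div {k n r : ℕ} (hr : r + 1 ≤ 2 * k) (u : Phase N) {x B : ℝ} (hB : 0 ≤ B)
    (hx : x ≤ B * (1 + ‖u‖) ^ (r + n)) : weight k n u * x ≤ 2 ^ (k + n) * B / (1 + ‖u‖) := by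
  have hu : 1 ≤ 1 + ‖u‖ := by linarith [norm_nonneg u]
  have hw := (weight_pos k n u).le
  rw [le_div_iff₀ (by positivity)]
  calc weight k n u * x * (1 + ‖u‖) ≤ weight k n u * (B * (1 + ‖u‖) ^ (r + n)) * (1 + ‖u‖) := by
        gcongr
    _ = B * (weight k n u * (1 + ‖u‖) ^ (r + n + 1)) := by ring
    _ ≤ B * (weight k n u * (1 + ‖u‖) ^ (2 * k + n)) := by
        have := pow_le_pow_right₀ hu (show r + n + 1 ≤ 2 * k + n by omega)
        gcongr
    _ ≤ B * 2 ^ (k + n) := by gcongr; exact weight_mul_le k n u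
    _ = _ := mul_comm _ _

/-- Functions whose derivatives grow slowly belong to `𝒱_k`. -/
theorem mem_VkSubmodule_of_bound {k r : ℕ} (hr : r + 1 ≤ 2 * k) {F : Phase N → ℂ}
    (hF : ∀ n : ℕ, ContDiff ℝ n F) {B : ℕ → ℝ} (hB : ∀ n, 0 ≤ B n)
    (h : ∀ n u, ‖iteratedFDeriv ℝ n F u‖ ≤ B n * (1 + ‖u‖) ^ (r + n)) :
    F ∈ VkSubmodule N k := by
  refine Submodule.mem_iInf _ |>.2 fun m => mem_Vkm.2 ⟨hF m, fun n _ J => ?_⟩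
  refine squeeze_zero_norm (fun u => (norm_weight_mul_partialDeriv_le k n J F u).trans
    (weight_mul_le_div hr u (hB n) (h n u))) ?_
  exact (tendsto_const_nhds (x := 2 ^ (k + n) * B n)).div_atTop
    (tendsto_atTop_add_const_left _ 1 (tendsto_norm_cocompact_atTop (E := Phase N)))

/-- With compact support the index k is free, so the K-th shell piece can be placed in 𝒱_K whatever
the order of T. -/
theorem mem_VkSubmodule_of_hasCompactSupport (k : ℕ) {F : Phase N → ℂ}
    (hF : ∀ n : ℕ, ContDiff ℝ n F) (hc : HasCompactSupport F) : F ∈ VkSubmodule N k := by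
  refine Submodule.mem_iInf _ |>.2 fun m => mem_Vkm.2 ⟨hF m, fun n _ J => ?_⟩
  refine tendsto_const_nhds.congr' ?_
  filter_upwards [hc.isCompact.compl_mem_cocompact] with u hu
  have : iteratedFDeriv ℝ n F u = 0 := by
    by_contra hne
    exact hu (support_iteratedFDeriv_subset n hne)
  simp [partialDeriv, this]

theorem pkm_le {k m : ℕ} (F : Vkm N k m) {M : ℝ}
    (h : ∀ n ≤ m, ∀ u, weight k n u * ‖iteratedFDeriv ℝ n (F : Phase N → ℂ) u‖ ≤ M) :
    pkm N k m F ≤ M := by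
  rw [pkm_apply]
  refine ciSup_le fun i => ?_
  exact (mul_le_mul_of_nonneg_left (norm_partialDeriv_le _ _ _ _) (weight_pos _ _ _).le).trans
    (h _ (Nat.lt_succ_iff.1 i.2.1.2) i.1)

/-! ### Membership in 𝒪_T and continuity in f -/

/-- The order of growth of the derivatives of `twistFun σ T f` depends on `T` only. -/
theorem exists_order_twistFun (σ : ℝ) (T : S2' N) :
    ∃ r : ℕ, ∀ n, ∃ Q : Seminorm ℂ (S2 N), Continuous Q ∧ ∀ f u,
      ‖iteratedFDeriv ℝ n (twistFun σ T f) u‖ ≤ Q f * (1 + ‖u‖) ^ (r + n) := by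
  have hT : Continuous ((normSeminorm ℂ ℂ).comp T.toLinearMap) := continuous_norm.comp T.continuous
  obtain ⟨r, P, hP, h⟩ := exists_bound_shift σ hT
  refine ⟨r, fun n => ?_⟩
  obtain ⟨C, hC, hn⟩ := exists_bound_iteratedFDeriv_twistFun N σ n
  obtain ⟨Q, hQ, hQe⟩ := exists_seminorm_eq_genSum σ n hP
  refine ⟨C.toNNReal • Q, hQ.const_smul C.toNNReal, fun f u => (hn T f u).trans ?_⟩
  have := genSum_mono (σ := σ) (a := fun g => ‖twistFun σ T g u‖) (fun g => h u g) n f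
  rw [hQe] at this
  rw [smul_apply, NNReal.smul_def, Real.coe_toNNReal _ hC, smul_eq_mul]
  calc _ ≤ C * (1 + ‖u‖) ^ n * ((1 + ‖u‖) ^ r * Q f) := by gcongr
    _ = _ := by ring

theorem exists_twistFun_mem (σ : ℝ) (T : S2' N) :
    ∃ k, ∀ f, twistFun σ T f ∈ VkSubmodule N k := by
  obtain ⟨r, h⟩ := exists_order_twistFun σ T
  choose Q _ hQ using h
  exact ⟨r + 1, fun f => mem_VkSubmodule_of_bound (by omega)
    (fun n => contDiff_twistFun σ T n f) (fun n => apply_nonneg (Q n) f) fun n u => hQ n f u⟩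

/-- The bilinear map `(T, f) ↦ (u ↦ ⟨T, f(u - ·) exp(i σ u'J·)⟩)` into `𝒪_T`. -/
def twistMap (N : ℕ) (σ : ℝ) : S2' N →ₗ[ℂ] S2 N →ₗ[ℂ] OT N :=
  LinearMap.mk₂ ℂ
    (fun T f => (⟨twistFun σ T f, (exists_twistFun_mem σ T).imp fun _ h => h f⟩ : OTSubmodule N))
    (fun _ _ _ => rfl) (fun _ _ _ => rfl)
    (fun T f g => Subtype.ext (funext fun u => by
      change T (shift σ u (f + g)) = T (shift σ u f) + T (shift σ u g)
      rw [map_add, map_add]))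
    (fun c T f => Subtype.ext (funext fun u => by
      change T (shift σ u (c • f)) = c • T (shift σ u f)
      rw [map_smul, map_smul]))

theorem twistMap_apply (σ : ℝ) (T : S2' N) (f : S2 N) (u : Phase N) :
    twistMap N σ T f u = twistFun σ T f u := rfl

/-- As the order r depends on T only, the map factors through the single space 𝒱_{r+1}, where
continuity is checked norm by norm. -/
theorem continuous_twistMap_right (σ : ℝ) (T : S2' N) : Continuous fun f => twistMap N σ T f := by
  obtain ⟨r, h⟩ := exists_order_twistFun σ T
  choose Q hQc hQ using h
  have hmem : ∀ f, twistFun σ T f ∈ VkSubmodule N (r + 1) := fun f =>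
    mem_VkSubmodule_of_bound (by omega) (fun n => contDiff_twistFun σ T n f)
      (fun n => apply_nonneg (Q n) f) fun n u => hQ n f u
  let L : S2 N →ₗ[ℂ] Vk N (r + 1) :=
    { toFun := fun f => (⟨twistFun σ T f, hmem f⟩ : VkSubmodule N (r + 1))
      map_add' := fun f g => Subtype.ext (funext fun u => by
        change T (shift σ u (f + g)) = T (shift σ u f) + T (shift σ u g)
        rw [map_add, map_add])
      map_smul' := fun c f => Subtype.ext (funext fun u => by
        change T (shift σ u (c • f)) = c • T (shift σ u f)
        rw [map_smul, map_smul]) }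
  refine (Vk.continuous_toOT N (r + 1)).comp (g := Vk.toOT N (r + 1)) (f := L) ?_
  refine (Vk.withSeminorms N (r + 1)).continuous_of_continuous_comp L fun m => ?_
  have hS : Continuous (∑ n ∈ Finset.range (m + 1), ((2 : ℝ≥0) ^ (r + 1 + n)) • Q n :
      Seminorm ℂ (S2 N)) :=
    Seminorm.continuous_finsetSum fun n _ => (hQc n).const_smul ((2 : ℝ≥0) ^ (r + 1 + n))
  refine Seminorm.continuous_of_le hS fun f => ?_
  refine pkm_le (Vk.toVkm N (r + 1) m (L f)) fun n hn u => ?_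
  have h0 : ∀ n, 0 ≤ Q n f := fun n => apply_nonneg _ _
  calc _ ≤ 2 ^ (r + 1 + n) * Q n f / (1 + ‖u‖) :=
        weight_mul_le_div (r := r) (by omega) u (h0 n) (hQ n f u)
    _ ≤ 2 ^ (r + 1 + n) * Q n f :=
        div_le_self (by have := h0 n; positivity) (by linarith [norm_nonneg u])
    _ ≤ ∑ n ∈ Finset.range (m + 1), 2 ^ (r + 1 + n) * Q n f :=
        Finset.single_le_sum (f := fun n => 2 ^ (r + 1 + n) * Q n f)
          (fun i _ => by have := h0 i; positivity) (Finset.mem_range.2 (by omega))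
    _ = _ := by
        rw [sum_apply]
        exact Finset.sum_congr rfl fun i _ => by
          rw [smul_apply, NNReal.smul_def, smul_eq_mul]; push_cast; rfl

/-! ### Cutoff functions and localized estimates -/

/-- A smooth function whose derivatives of order `n` are bounded by `c n`. -/
structure BddDerivs (c : ℕ → ℝ) (χ : Phase N → ℂ) : Prop where
  contDiff : ∀ n : ℕ, ContDiff ℝ n χ
  bound : ∀ n u, ‖iteratedFDeriv ℝ n χ u‖ ≤ c n

theorem BddDerivs.nonneg {c : ℕ → ℝ} {χ : Phase N → ℂ} (h : BddDerivs c χ) (n : ℕ) : 0 ≤ c n :=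
  (norm_nonneg _).trans (h.bound n 0)

theorem BddDerivs.sub {c c' : ℕ → ℝ} {χ χ' : Phase N → ℂ} (h : BddDerivs c χ)
    (h' : BddDerivs c' χ') : BddDerivs (fun n => c n + c' n) (fun u => χ u - χ' u) := by
  refine ⟨fun n => (h.contDiff n).sub (h'.contDiff n), fun n u => ?_⟩
  have : iteratedFDeriv ℝ n (fun u => χ u - χ' u) u =
      iteratedFDeriv ℝ n χ u - iteratedFDeriv ℝ n χ' u :=
    iteratedFDeriv_sub_apply (h.contDiff n).contDiffAt (h'.contDiff n).contDiffAt
  rw [this]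
  exact (norm_sub_le _ _).trans (add_le_add (h.bound n u) (h'.bound n u))

theorem bddDerivs_const {c : ℕ → ℝ} (hc : ∀ n, 0 ≤ c n) (z : ℂ) (hz : ‖z‖ ≤ c 0) :
    BddDerivs (N := N) c fun _ => z := by
  refine ⟨fun n => contDiff_const, fun n u => ?_⟩
  rcases n with _ | n
  · simpa using hz
  · rw [iteratedFDeriv_const_of_ne (Nat.succ_ne_zero n)]
    simpa using hc (n + 1)

theorem BddDerivs.norm_iteratedFDeriv_mul_le {c : ℕ → ℝ} {χ F : Phase N → ℂ} (h : BddDerivs c χ)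
    (hF : ∀ n : ℕ, ContDiff ℝ n F) (n : ℕ) (u : Phase N) {A : ℝ} (hA : 0 ≤ A)
    (hFA : ∀ i ≤ n, ‖iteratedFDeriv ℝ i F u‖ ≤ (1 + ‖u‖) ^ i * A) :
    ‖iteratedFDeriv ℝ n (fun u => χ u * F u) u‖ ≤
      (∑ i ∈ Finset.range (n + 1), n.choose i * c i) * ((1 + ‖u‖) ^ n * A) := by
  refine (_root_.norm_iteratedFDeriv_mul_le (h.contDiff n) (hF n) u le_rfl).trans ?_
  rw [Finset.sum_mul]
  refine Finset.sum_le_sum fun i _ => ?_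
  have hu : 1 ≤ 1 + ‖u‖ := by linarith [norm_nonneg u]
  have h1 : ‖iteratedFDeriv ℝ (n - i) F u‖ ≤ (1 + ‖u‖) ^ n * A :=
    (hFA (n - i) (Nat.sub_le n i)).trans
      (mul_le_mul_of_nonneg_right (pow_le_pow_right₀ hu (Nat.sub_le n i)) hA)
  have h2 := h.nonneg i
  have h3 := h.bound i u
  gcongr

/-- A cutoff function that is `1` on the unit ball and `0` outside of the ball of radius `2`. -/
theorem exists_cutoff (N : ℕ) : ∃ η : S2 N, (∀ u, ‖u‖ ≤ 1 → η u = 1) ∧ ∀ u, 2 ≤ ‖u‖ → η u = 0 := by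
  let φ : ContDiffBump (0 : Phase N) := ⟨1, 2, one_pos, one_lt_two⟩
  have hs : HasCompactSupport fun u => (φ u : ℂ) :=
    φ.hasCompactSupport.comp_left (g := ((↑) : ℝ → ℂ)) Complex.ofReal_zero
  refine ⟨hs.toSchwartzMap (Complex.ofRealCLM.contDiff.comp φ.contDiff), fun u hu => ?_,
    fun u hu => ?_⟩
  · change ((φ u : ℝ) : ℂ) = 1
    rw [φ.one_of_mem_closedBall (by simpa using hu), Complex.ofReal_one]
  · change ((φ u : ℝ) : ℂ) = 0
    rw [φ.zero_of_le_dist (by simpa using hu), Complex.ofReal_zero]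

/-- Dilation by a factor R⁻¹ ≤ 1 does not increase derivative bounds, so the same constants serve
for all radii. The constants can then be fixed before the radii are chosen. -/
theorem bddDerivs_dilation (η : S2 N) {R : ℝ} (hR : 1 ≤ R) :
    BddDerivs (fun n => SchwartzMap.seminorm ℂ 0 n η) fun u => η (R⁻¹ • u) := by
  let g : Phase N →L[ℝ] Phase N := R⁻¹ • ContinuousLinearMap.id ℝ (Phase N)
  refine ⟨fun n => (η.smooth n).comp g.contDiff, fun n u => ?_⟩
  change ‖iteratedFDeriv ℝ n (η ∘ g) u‖ ≤ _
  rw [g.iteratedFDeriv_comp_right (η.smooth n) u le_rfl]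
  refine (ContinuousMultilinearMap.norm_compContinuousLinearMap_le _ _).trans ?_
  have hg : ‖g‖ ≤ 1 := by
    refine ContinuousLinearMap.opNorm_le_bound _ zero_le_one fun v => ?_
    change ‖R⁻¹ • v‖ ≤ _
    rw [norm_smul, Real.norm_of_nonneg (by positivity)]
    gcongr
    exact inv_le_one_of_one_le₀ hR
  refine (mul_le_of_le_one_right (norm_nonneg _) ?_).trans
    (SchwartzMap.norm_iteratedFDeriv_le_seminorm ℂ η n _)
  exact Finset.prod_le_one (fun _ _ => norm_nonneg _) fun _ _ => hg

/-- Increasing sequences of cutoff functions, with derivatives bounded uniformly in the radii. -/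
theorem exists_cutoff_sequence (N : ℕ) : ∃ c : ℕ → ℝ, (∀ n, 0 ≤ c n) ∧ 1 ≤ c 0 ∧
    ∀ R : ℕ → ℝ, (∀ K : ℕ, (K : ℝ) ≤ R K) → ∃ θ : ℕ → Phase N → ℂ, (∀ K, BddDerivs c (θ K)) ∧
      (∀ u, θ 0 u = 0) ∧ (∀ K ≠ 0, ∀ u, ‖u‖ ≤ R K → θ K u = 1) ∧
      ∀ K u, 2 * R K ≤ ‖u‖ → θ K u = 0 := by
  obtain ⟨η, h1, h0⟩ := exists_cutoff N
  have hc : ∀ n, 0 ≤ SchwartzMap.seminorm ℂ 0 n η := fun n => apply_nonneg _ _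
  refine ⟨fun n => SchwartzMap.seminorm ℂ 0 n η, hc, ?_, fun R hR =>
    -- Taking θ 0 = 0 makes the differences θ (K+1) - θ K telescope to θ; for K ≠ 0 the radius is at
    -- least 1.
    ⟨fun K u => if K = 0 then 0 else η ((R K)⁻¹ • u), fun K => ?_, fun u => if_pos rfl,
      fun K hK u hu => ?_, fun K u hu => ?_⟩⟩
  · have := SchwartzMap.norm_le_seminorm ℂ η 0
    rwa [h1 0 (by simp), norm_one] at this
  · by_cases hK : K = 0
    · simp only [if_pos hK]
      exact bddDerivs_const hc 0 (by simp)
    · simp only [if_neg hK]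
      refine bddDerivs_dilation η (le_trans ?_ (hR K))
      exact_mod_cast Nat.one_le_iff_ne_zero.2 hK
  · have hRK : 0 < R K := (Nat.cast_pos.2 (Nat.pos_of_ne_zero hK)).trans_le (hR K)
    simp only [if_neg hK]
    refine h1 _ ?_
    rw [norm_smul, norm_inv, Real.norm_of_nonneg hRK.le, inv_mul_le_iff₀ hRK, mul_one]
    exact hu
  · by_cases hK : K = 0
    · simp only [if_pos hK]
    have hRK : 0 < R K := (Nat.cast_pos.2 (Nat.pos_of_ne_zero hK)).trans_le (hR K)
    simp only [if_neg hK]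
    refine h0 _ ?_
    rw [norm_smul, norm_inv, Real.norm_of_nonneg hRK.le, ← div_eq_inv_mul, le_div_iff₀ hRK]
    exact hu

theorem norm_iteratedFDeriv_twistFun_le_of_genWords (N : ℕ) (σ : ℝ) (m : ℕ) :
    ∃ C : ℝ, 0 ≤ C ∧ ∀ (T : S2' N) (f : S2 N) (u : Phase N) (ε : ℝ), 0 ≤ ε →
      (∀ g ∈ genWords σ m f, ‖twistFun σ T g u‖ ≤ ε) →
      ∀ n ≤ m, ‖iteratedFDeriv ℝ n (twistFun σ T f) u‖ ≤ (1 + ‖u‖) ^ n * (C * ε) := by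
  choose C hC h using exists_bound_iteratedFDeriv_twistFun N σ
  set d : ℝ := (1 + Fintype.card (Fin N ⊕ Fin N) : ℝ) ^ m with hd
  have hd0 : 0 ≤ d := by positivity
  have hS : 0 ≤ ∑ i ∈ Finset.range (m + 1), C i := Finset.sum_nonneg fun i _ => hC i
  refine ⟨(∑ i ∈ Finset.range (m + 1), C i) * d, by positivity, fun T f u ε hε hg n hn => ?_⟩
  have h1 := genSum_le_of_genWords (a := fun g => ‖twistFun σ T g u‖) m f hg
  have h2 := monotone_genSum (σ := σ) (a := fun g => ‖twistFun σ T g u‖)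
    (fun g => norm_nonneg _) f hn
  have h3 : C n ≤ ∑ i ∈ Finset.range (m + 1), C i :=
    Finset.single_le_sum (fun i _ => hC i) (Finset.mem_range.2 (by omega))
  calc _ ≤ C n * (1 + ‖u‖) ^ n * genSum σ n (fun g => ‖twistFun σ T g u‖) f := h n T f u
    _ ≤ (∑ i ∈ Finset.range (m + 1), C i) * (1 + ‖u‖) ^ n * (d * ε) :=
        mul_le_mul (by gcongr) (h2.trans h1) (genSum_nonneg (fun g => norm_nonneg _) n f)
          (by positivity)
    _ = _ := by ring

/-- The norms of `χ · twistFun σ T f` in `𝒱_k` are controlled by the values of finitely many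
functions `twistFun σ T g` on the support of `χ`. -/
theorem exists_bound_cutoff_twistFun (N : ℕ) (σ : ℝ) {c : ℕ → ℝ} (hc : ∀ n, 0 ≤ c n) (k m : ℕ) :
    ∃ M : ℝ, 0 ≤ M ∧ ∀ (χ : Phase N → ℂ) (Z : Set (Phase N)) (T : S2' N) (f : S2 N) (ε : ℝ),
      BddDerivs c χ → (∀ u ∉ Z, χ =ᶠ[𝓝 u] 0) → 0 ≤ ε →
      (∀ u ∈ Z, ∀ g ∈ genWords σ m f, ‖twistFun σ T g u‖ ≤ ε * (1 + ‖u‖) ^ (2 * k)) →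
      ∀ n ≤ m, ∀ u, weight k n u * ‖iteratedFDeriv ℝ n (fun u => χ u * twistFun σ T f u) u‖ ≤
        M * ε := by
  obtain ⟨C, hC, h⟩ := norm_iteratedFDeriv_twistFun_le_of_genWords N σ m
  -- The factors come from the weight (`weight_mul_le`), from Leibniz' rule with the cutoff, and
  -- from the control of derivatives by values.
  set b : ℕ → ℝ := fun n => 2 ^ (k + n) * (∑ i ∈ Finset.range (n + 1), n.choose i * c i) * C with hb
  have hb0 : ∀ n, 0 ≤ b n := fun n => by
    have : 0 ≤ ∑ i ∈ Finset.range (n + 1), n.choose i * c i :=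
      Finset.sum_nonneg fun i _ => mul_nonneg (by positivity) (hc i)
    positivity
  have hM : 0 ≤ ∑ n ∈ Finset.range (m + 1), b n := Finset.sum_nonneg fun n _ => hb0 n
  refine ⟨∑ n ∈ Finset.range (m + 1), b n, hM, fun χ Z T f ε hχ hZ hε hT n hn u => ?_⟩
  by_cases hu : u ∈ Z
  · have h1 := hχ.norm_iteratedFDeriv_mul_le (fun n => contDiff_twistFun σ T n f) n u
      (A := C * (ε * (1 + ‖u‖) ^ (2 * k))) (by positivity)
      fun i hi => h T f u _ (by positivity) (hT u hu) i (hi.trans hn)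
    have hs : 0 ≤ ∑ i ∈ Finset.range (n + 1), n.choose i * c i :=
      Finset.sum_nonneg fun i _ => mul_nonneg (by positivity) (hc i)
    calc _ ≤ weight k n u * _ := mul_le_mul_of_nonneg_left h1 (weight_pos k n u).le
      _ = (∑ i ∈ Finset.range (n + 1), n.choose i * c i) * C * ε *
          (weight k n u * (1 + ‖u‖) ^ (2 * k + n)) := by ring
      _ ≤ (∑ i ∈ Finset.range (n + 1), n.choose i * c i) * C * ε * 2 ^ (k + n) := by
          gcongr
          exact weight_mul_le k n u
      _ = b n * ε := by rw [hb]; ring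
      _ ≤ _ := by
          gcongr
          exact Finset.single_le_sum (fun n _ => hb0 n) (Finset.mem_range.2 (by omega))
  · have : (fun u => χ u * twistFun σ T f u) =ᶠ[𝓝 u] fun _ => 0 := by
      filter_upwards [hZ u hu] with v hv
      rw [hv, Pi.zero_apply, zero_mul]
    rw [(this.iteratedFDeriv (𝕜 := ℝ) n).eq_of_nhds]
    simp only [iteratedFDeriv_fun_zero, Pi.zero_apply, norm_zero, mul_zero]
    positivity

/-- A function in `VkSubmodule N k` as an element of `𝒱_k`. -/
def Vk.of {k : ℕ} {F : Phase N → ℂ} (hF : F ∈ VkSubmodule N k) : Vk N k :=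
  (⟨F, hF⟩ : VkSubmodule N k)

theorem Vk.toFun_toOT_of {k : ℕ} {F : Phase N → ℂ} (hF : F ∈ VkSubmodule N k) :
    OT.toFun N (Vk.toOT N k (Vk.of hF)) = F := rfl

theorem OT.toFun_injective (N : ℕ) : Function.Injective (OT.toFun N) := Subtype.coe_injective

/-- On 𝒱_k a continuous seminorm is dominated by finitely many p_{k,m}, and bounds up to the largest
of these m control them all. -/
theorem exists_bound_toOT {q : Seminorm ℂ (OT N)} (hq : Continuous q) (k : ℕ) :
    ∃ (m : ℕ) (C : ℝ), 0 ≤ C ∧ ∀ {F : Phase N → ℂ} (hF : F ∈ VkSubmodule N k) (M : ℝ),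
      (∀ n ≤ m, ∀ u, weight k n u * ‖iteratedFDeriv ℝ n F u‖ ≤ M) →
      q (Vk.toOT N k (Vk.of hF)) ≤ C * M := by
  have hqk : Continuous (q.comp (Vk.toOT N k)) := hq.comp (Vk.continuous_toOT N k)
  obtain ⟨s, C, -, h⟩ := Seminorm.bound_of_continuous (Vk.withSeminorms N k) _ hqk
  refine ⟨s.sup id, C, C.2, fun hF M hM => (h (Vk.of hF)).trans ?_⟩
  rw [smul_apply, NNReal.smul_def, smul_eq_mul]
  have hM0 : 0 ≤ M :=
    (mul_nonneg (weight_pos k 0 0).le (norm_nonneg _)).trans (hM 0 (Nat.zero_le _) 0)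
  refine mul_le_mul_of_nonneg_left (Seminorm.finset_sup_apply_le hM0 fun m hm => ?_) C.2
  exact pkm_le (Vk.toVkm N k m (Vk.of hF)) fun n hn u =>
    hM n (hn.trans (Finset.le_sup (f := id) hm)) u

/-- The spare power of `weight_mul_le_div` in 𝒱_{r+1} is at most 1/(1+R) where ‖u‖ ≥ R. The point is
that D does not depend on χ or R, so the tail tends to 0 as R grows. -/
theorem exists_remainder_bound (σ : ℝ) {c : ℕ → ℝ} (hc : ∀ n, 0 ≤ c n) (T : S2' N) (f : S2 N) :
    ∃ k, ∀ m, ∃ D : ℝ, 0 ≤ D ∧ ∀ (χ : Phase N → ℂ) (R : ℝ), 0 ≤ R → BddDerivs c χ →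
      (∀ u, ‖u‖ < R → χ =ᶠ[𝓝 u] 0) → (fun u => χ u * twistFun σ T f u) ∈ VkSubmodule N k ∧
      ∀ n ≤ m, ∀ u, weight k n u * ‖iteratedFDeriv ℝ n (fun u => χ u * twistFun σ T f u) u‖ ≤
        D / (1 + R) := by
  obtain ⟨r, h⟩ := exists_order_twistFun σ T
  choose Q _ hQ using h
  have hQ0 : ∀ n, 0 ≤ Q n f := fun n => apply_nonneg _ _
  set B : ℕ → ℝ := fun n => (∑ i ∈ Finset.range (n + 1), n.choose i * c i) *
    ∑ i ∈ Finset.range (n + 1), Q i f with hB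
  have hB0 : ∀ n, 0 ≤ B n := fun n => mul_nonneg
    (Finset.sum_nonneg fun i _ => mul_nonneg (by positivity) (hc i))
    (Finset.sum_nonneg fun i _ => hQ0 i)
  have key : ∀ χ : Phase N → ℂ, BddDerivs c χ → ∀ n u,
      ‖iteratedFDeriv ℝ n (fun u => χ u * twistFun σ T f u) u‖ ≤ B n * (1 + ‖u‖) ^ (r + n) := by
    intro χ hχ n u
    have hS : 0 ≤ ∑ i ∈ Finset.range (n + 1), Q i f := Finset.sum_nonneg fun i _ => hQ0 i
    refine (hχ.norm_iteratedFDeriv_mul_le (fun n => contDiff_twistFun σ T n f) n u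
      (A := (1 + ‖u‖) ^ r * ∑ i ∈ Finset.range (n + 1), Q i f) (by positivity)
      fun i hi => ?_).trans (le_of_eq (by rw [hB]; ring))
    have h1 : Q i f ≤ ∑ i ∈ Finset.range (n + 1), Q i f :=
      Finset.single_le_sum (f := fun i => Q i f) (fun i _ => hQ0 i)
        (Finset.mem_range.2 (by omega))
    calc _ ≤ Q i f * (1 + ‖u‖) ^ (r + i) := hQ i f u
      _ ≤ (∑ i ∈ Finset.range (n + 1), Q i f) * (1 + ‖u‖) ^ (r + i) := by gcongr
      _ = _ := by ring
  refine ⟨r + 1, fun m => ?_⟩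
  have hD : ∀ n, 0 ≤ 2 ^ (r + 1 + n) * B n := fun n => mul_nonneg (by positivity) (hB0 n)
  have hD0 : 0 ≤ ∑ n ∈ Finset.range (m + 1), 2 ^ (r + 1 + n) * B n :=
    Finset.sum_nonneg fun n _ => hD n
  refine ⟨∑ n ∈ Finset.range (m + 1), 2 ^ (r + 1 + n) * B n, hD0, fun χ R hR hχ hz => ⟨?_, ?_⟩⟩
  · exact mem_VkSubmodule_of_bound (by omega)
      (fun n => (hχ.contDiff n).mul (contDiff_twistFun σ T n f)) hB0 (key χ hχ)
  · intro n hn u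
    rcases lt_or_ge ‖u‖ R with hu | hu
    · have : (fun u => χ u * twistFun σ T f u) =ᶠ[𝓝 u] fun _ => 0 := by
        filter_upwards [hz u hu] with v hv
        rw [hv, Pi.zero_apply, zero_mul]
      rw [(this.iteratedFDeriv (𝕜 := ℝ) n).eq_of_nhds]
      simp only [iteratedFDeriv_fun_zero, Pi.zero_apply, norm_zero, mul_zero]
      positivity
    · refine (weight_mul_le_div (r := r) (by omega) u (hB0 n) (key χ hχ n u)).trans ?_
      have h1 : 2 ^ (r + 1 + n) * B n ≤ ∑ n ∈ Finset.range (m + 1), 2 ^ (r + 1 + n) * B n :=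
        Finset.single_le_sum (f := fun n => 2 ^ (r + 1 + n) * B n) (fun n _ => hD n)
          (Finset.mem_range.2 (by omega))
      gcongr

/-! ### Continuity in T -/

/-- Radii for which suitable multiples of the functions `shift σ u g`, with `u` in the successive
shells, form a bounded subset of `𝓢₂`. -/
theorem exists_radii (σ : ℝ) (f : S2 N) (m : ℕ → ℕ) {a : ℕ → ℝ} (ha : ∀ K, 0 < a K) :
    ∃ R : ℕ → ℝ, R 0 = 0 ∧ Monotone R ∧ (∀ K : ℕ, (K : ℝ) ≤ R K) ∧
      Bornology.IsVonNBounded ℂ {x : S2 N | ∃ (K : ℕ) (u : Phase N) (g : S2 N), R K ≤ ‖u‖ ∧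
        ‖u‖ ≤ 2 * R (K + 1) ∧ g ∈ genWords σ (m K) f ∧
        x = (((a K * (1 + ‖u‖) ^ (2 * K))⁻¹ : ℝ) : ℂ) • shift σ u g} := by
  choose r P _ hP using fun i : ℕ × ℕ =>
    exists_bound_shift σ (continuous_schwartzSeminorm (N := N) i.1 i.2)
  have hw : ∀ (K : ℕ) (i : ℕ × ℕ), ∃ w : ℝ, 0 ≤ w ∧ ∀ g ∈ genWords σ (m K) f, P i g ≤ w := by
    intro K i
    obtain ⟨w, hw⟩ := ((finite_genWords σ (m K) f).image (P i)).bddAbove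
    exact ⟨max w 0, le_max_right _ _, fun g hg => (hw ⟨g, hg, rfl⟩).trans (le_max_left _ _)⟩
  choose w hw0 hw using hw
  have hwa : ∀ K i, 0 ≤ w K i / a K := fun K i => div_nonneg (hw0 K i) (ha K).le
  -- A diagonal choice: b K takes in the seminorms with both indices at most K, so each seminorm is
  -- covered for all large K. The radii are then built with R K ≥ b K for K ≠ 0.
  set b : ℕ → ℝ := fun K =>
    ∑ i ∈ Finset.range (K + 1) ×ˢ Finset.range (K + 1), w K i / a K with hb
  have hb0 : ∀ K, 0 ≤ b K := fun K => Finset.sum_nonneg fun i _ => hwa K i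
  set R : ℕ → ℝ := fun K => ∑ k ∈ Finset.range K, (1 + b (k + 1)) with hR
  have hstep : ∀ k, 0 ≤ 1 + b (k + 1) := fun k => by linarith [hb0 (k + 1)]
  have hRmono : Monotone R := monotone_nat_of_le_succ fun K => by
    simp only [hR, Finset.sum_range_succ]
    linarith [hstep K]
  have hR0 : R 0 = 0 := by simp [hR]
  have hRK : ∀ K : ℕ, (K : ℝ) ≤ R K := fun K => by
    calc (K : ℝ) = ∑ _k ∈ Finset.range K, (1 : ℝ) := by simp
      _ ≤ _ := Finset.sum_le_sum fun k _ => by linarith [hb0 (k + 1)]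
  have hbR : ∀ K ≠ 0, b K ≤ R K := by
    intro K hK
    obtain ⟨k, rfl⟩ := Nat.exists_eq_succ_of_ne_zero hK
    have : R (k + 1) = R k + (1 + b (k + 1)) := Finset.sum_range_succ _ k
    have h1 : 0 ≤ R k := (Nat.cast_nonneg k).trans (hRK k)
    change b (k + 1) ≤ R (k + 1)
    linarith
  refine ⟨R, hR0, hRmono, hRK, ?_⟩
  rw [(schwartz_withSeminorms ℂ (Phase N) ℂ).isVonNBounded_iff_seminorm_bounded]
  intro i
  -- From K₀ on, seminorm i is counted in b K and 2K ≥ r i + 1. The spare factor 1+‖u‖ ≥ R K then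
  -- absorbs w K i / a K, so the bound is 1; the finitely many earlier shells are bounded sets of u
  -- and are bounded one by one by β.
  set K₀ : ℕ := max (max i.1 i.2) (r i) + 1 with hK₀
  set β : ℕ → ℝ := fun K => (a K)⁻¹ * ((1 + 2 * R (K + 1)) ^ r i * w K i) with hβ
  have hβ0 : ∀ K, 0 ≤ β K := fun K => by
    have h1 := (ha K).le
    have h2 := hw0 K i
    have h3 : 0 ≤ R (K + 1) := (Nat.cast_nonneg _).trans (hRK _)
    positivity
  have hS : 0 ≤ ∑ K ∈ Finset.range K₀, β K := Finset.sum_nonneg fun K _ => hβ0 K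
  refine ⟨2 + ∑ K ∈ Finset.range K₀, β K, by linarith, ?_⟩
  rintro _ ⟨K, u, g, hu, hu', hg, rfl⟩
  have hu1 : 1 ≤ 1 + ‖u‖ := by linarith [norm_nonneg u]
  have haK := ha K
  have hwK := hw0 K i
  have hle : schwartzSeminormFamily ℂ (Phase N) ℂ i
      ((((a K * (1 + ‖u‖) ^ (2 * K))⁻¹ : ℝ) : ℂ) • shift σ u g) ≤
      (a K * (1 + ‖u‖) ^ (2 * K))⁻¹ * ((1 + ‖u‖) ^ r i * w K i) := by
    rw [map_smul_eq_mul, Complex.norm_real, Real.norm_of_nonneg (by positivity)]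
    refine mul_le_mul_of_nonneg_left ((hP i u g).trans ?_) (by positivity)
    gcongr
    exact hw K i g hg
  refine hle.trans_lt ?_
  rcases lt_or_ge K K₀ with hK | hK
  · have h1 : (a K * (1 + ‖u‖) ^ (2 * K))⁻¹ * ((1 + ‖u‖) ^ r i * w K i) ≤ β K := by
      have : (a K * (1 + ‖u‖) ^ (2 * K))⁻¹ ≤ (a K)⁻¹ :=
        inv_anti₀ haK (le_mul_of_one_le_right haK.le (one_le_pow₀ hu1))
      simp only [hβ]
      gcongr
    have h2 : β K ≤ ∑ K ∈ Finset.range K₀, β K :=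
      Finset.single_le_sum (fun K _ => hβ0 K) (Finset.mem_range.2 hK)
    linarith
  · have hK0 : K ≠ 0 := by omega
    have hri : r i + 1 ≤ 2 * K := by
      have := le_max_right (max i.1 i.2) (r i)
      omega
    have hi1 : i.1 < K + 1 := by
      have := (le_max_left i.1 i.2).trans (le_max_left (max i.1 i.2) (r i))
      omega
    have hi2 : i.2 < K + 1 := by
      have := (le_max_right i.1 i.2).trans (le_max_left (max i.1 i.2) (r i))
      omega
    have h1 : w K i / a K ≤ b K :=
      Finset.single_le_sum (f := fun i => w K i / a K) (fun i _ => hwa K i)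
        (Finset.mem_product.2 ⟨Finset.mem_range.2 hi1, Finset.mem_range.2 hi2⟩)
    have h2 : w K i / a K ≤ 1 + ‖u‖ := by linarith [hbR K hK0]
    have h3 : (a K * (1 + ‖u‖) ^ (2 * K))⁻¹ * ((1 + ‖u‖) ^ r i * w K i) ≤ 1 := by
      rw [inv_mul_le_iff₀ (by positivity), mul_one]
      calc (1 + ‖u‖) ^ r i * w K i ≤ (1 + ‖u‖) ^ r i * ((1 + ‖u‖) * a K) := by
            gcongr
            exact (div_le_iff₀ haK).1 h2
        _ = a K * (1 + ‖u‖) ^ (r i + 1) := by ring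
        _ ≤ _ := by gcongr
    linarith

theorem sum_two_inv_pow_le (J : ℕ) : ∑ K ∈ Finset.range J, ((2 : ℝ) ^ (K + 2))⁻¹ ≤ 1 / 2 := by
  have : ∑ K ∈ Finset.range J, ((2 : ℝ) ^ (K + 2))⁻¹ = 1 / 2 - ((2 : ℝ) ^ (J + 1))⁻¹ := by
    induction J with
    | zero => norm_num
    | succ J ih =>
      rw [Finset.sum_range_succ, ih]
      field_simp
      ring
  rw [this]
  have : (0 : ℝ) < ((2 : ℝ) ^ (J + 1))⁻¹ := by positivity
  linarith

/-- The neighbourhood is the polar of the bounded set from `exists_radii`, chosen from q and f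
alone. Only the number of pieces and the space containing the remainder depend on T. -/
theorem closedBall_mem_nhds_twistMap (σ : ℝ) (f : S2 N) {q : Seminorm ℂ (OT N)}
    (hq : Continuous q) :
    (q.comp ((twistMap N σ).flip f)).closedBall 0 1 ∈ 𝓝 (0 : S2' N) := by
  obtain ⟨c₀, hc₀, hc₁, hcut⟩ := exists_cutoff_sequence N
  -- Bounds both the differences of two cutoffs and the functions 1 - θ K.
  set c : ℕ → ℝ := fun n => c₀ n + c₀ n with hcdef
  have hc : ∀ n, 0 ≤ c n := fun n => add_nonneg (hc₀ n) (hc₀ n)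
  choose m C hC hqb using exists_bound_toOT hq
  choose M hM0 hM using fun K => exists_bound_cutoff_twistFun N σ hc K (m K)
  -- Chosen so that q of the K-th piece is at most 2^{-(K+2)}, with sum at most 1/2; the other 1/2
  -- is left to the remainder. The +1 keeps the denominator positive.
  set a : ℕ → ℝ := fun K => ((2 : ℝ) ^ (K + 2))⁻¹ / (C K * M K + 1) with ha
  have hCM : ∀ K, 0 < C K * M K + 1 := fun K => by
    have := mul_nonneg (hC K) (hM0 K)
    linarith
  have ha0 : ∀ K, 0 < a K := fun K => div_pos (by positivity) (hCM K)
  obtain ⟨R, hR0, hRmono, hRK, hbdd⟩ := exists_radii σ f m ha0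
  obtain ⟨θ, hθ, hθ0, hθ1, hθ2⟩ := hcut R hRK
  set χ : ℕ → Phase N → ℂ := fun K u => θ (K + 1) u - θ K u with hχdef
  have hχ : ∀ K, BddDerivs c (χ K) := fun K => (hθ (K + 1)).sub (hθ K)
  have hsupp : ∀ K u, 2 * R (K + 1) ≤ ‖u‖ → χ K u = 0 := fun K u hu => by
    have h1 := hRmono (Nat.le_succ K)
    simp only [hχdef]
    rw [hθ2 (K + 1) u hu, hθ2 K u (by linarith), sub_zero]
  have hshell : ∀ K, ∀ u ∉ {u : Phase N | R K ≤ ‖u‖ ∧ ‖u‖ ≤ 2 * R (K + 1)}, χ K =ᶠ[𝓝 u] 0 := by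
    intro K u hu
    rcases lt_or_ge ‖u‖ (R K) with h | h
    · have hK : K ≠ 0 := by
        rintro rfl
        rw [hR0] at h
        exact absurd (norm_nonneg u) (not_le.2 h)
      filter_upwards [(continuous_norm.continuousAt (x := u)).eventually_lt_const h] with v hv
      simp only [hχdef, Pi.zero_apply]
      rw [hθ1 K hK v hv.le, hθ1 (K + 1) (Nat.succ_ne_zero K) v
        (hv.le.trans (hRmono (Nat.le_succ K))), sub_self]
    · have h' : 2 * R (K + 1) < ‖u‖ := not_le.1 fun h' => hu ⟨h, h'⟩
      filter_upwards [(continuous_norm.continuousAt (x := u)).eventually_const_lt h'] with v hv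
      exact hsupp K v hv.le
  -- This is where the strong topology enters: functionals bounded by 1 on a bounded set form a
  -- neighbourhood of 0.
  have hev := ContinuousLinearMap.eventually_nhds_zero_mapsTo (σ := RingHom.id ℂ) hbdd
    (Metric.closedBall_mem_nhds (0 : ℂ) one_pos)
  filter_upwards [hev] with T hT
  have hTw : ∀ K, ∀ u ∈ {u : Phase N | R K ≤ ‖u‖ ∧ ‖u‖ ≤ 2 * R (K + 1)},
      ∀ g ∈ genWords σ (m K) f, ‖twistFun σ T g u‖ ≤ a K * (1 + ‖u‖) ^ (2 * K) := by
    intro K u hu g hg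
    have hpos : 0 < a K * (1 + ‖u‖) ^ (2 * K) := mul_pos (ha0 K) (by positivity)
    have := hT ⟨K, u, g, hu.1, hu.2, hg, rfl⟩
    rw [mem_closedBall_zero_iff, map_smul, norm_smul, Complex.norm_real,
      Real.norm_of_nonneg (inv_nonneg.2 hpos.le), inv_mul_le_iff₀ hpos, mul_one] at this
    exact this
  have hmem : ∀ K, (fun u => χ K u * twistFun σ T f u) ∈ VkSubmodule N K := by
    intro K
    refine mem_VkSubmodule_of_hasCompactSupport K
      (fun n => ((hχ K).contDiff n).mul (contDiff_twistFun σ T n f)) ?_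
    refine HasCompactSupport.mul_right (HasCompactSupport.intro
      (isCompact_closedBall (0 : Phase N) (2 * R (K + 1))) fun u hu => hsupp K u ?_)
    rw [mem_closedBall_zero_iff, not_le] at hu
    exact hu.le
  have hpiece : ∀ K, q (Vk.toOT N K (Vk.of (hmem K))) ≤ ((2 : ℝ) ^ (K + 2))⁻¹ := by
    intro K
    refine (hqb K (hmem K) (M K * a K) (hM K (χ K) _ T f (a K) (hχ K) (hshell K) (ha0 K).le
      (hTw K))).trans ?_
    have h1 : C K * M K * a K ≤ (C K * M K + 1) * a K :=
      mul_le_mul_of_nonneg_right (by linarith) (ha0 K).le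
    have h2 : (C K * M K + 1) * a K = ((2 : ℝ) ^ (K + 2))⁻¹ := mul_div_cancel₀ _ (hCM K).ne'
    linarith
  -- Here k, D and J may depend on T, since the neighbourhood is already fixed.
  obtain ⟨k, hk⟩ := exists_remainder_bound σ hc T f
  obtain ⟨D, hD0, hD⟩ := hk (m k)
  obtain ⟨J, hJ⟩ := exists_nat_ge (2 * (C k * D))
  have hJ' : 2 * (C k * D) ≤ R (J + 1) := by
    have := hRK (J + 1)
    push_cast at this
    linarith
  have hRJ : 0 ≤ R (J + 1) := (Nat.cast_nonneg _).trans (hRK _)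
  have hone : BddDerivs (N := N) c₀ fun _ => 1 := bddDerivs_const hc₀ 1 (by simpa using hc₁)
  have hrem := hD (fun u => 1 - θ (J + 1) u) (R (J + 1)) hRJ (hone.sub (hθ (J + 1)))
    fun u hu => by
      filter_upwards [(continuous_norm.continuousAt (x := u)).eventually_lt_const hu] with v hv
      rw [hθ1 (J + 1) (Nat.succ_ne_zero J) v hv.le, sub_self, Pi.zero_apply]
  have hremq : q (Vk.toOT N k (Vk.of hrem.1)) ≤ 1 / 2 := by
    refine (hqb k hrem.1 _ hrem.2).trans ?_
    rw [← mul_div_assoc, div_le_iff₀ (by linarith)]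
    linarith
  have hdecomp : twistMap N σ T f = ∑ K ∈ Finset.range (J + 1), Vk.toOT N K (Vk.of (hmem K)) +
      Vk.toOT N k (Vk.of hrem.1) := by
    apply OT.toFun_injective N
    rw [map_add, map_sum]
    simp only [Vk.toFun_toOT_of]
    ext u
    rw [Pi.add_apply, Finset.sum_apply, ← Finset.sum_mul]
    have : ∑ K ∈ Finset.range (J + 1), χ K u = θ (J + 1) u := by
      simp only [hχdef]
      rw [Finset.sum_range_sub (fun K => θ K u), hθ0, sub_zero]
    rw [this, twistMap_apply]
    ring
  rw [Seminorm.mem_closedBall_zero]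
  change q (twistMap N σ T f) ≤ 1
  rw [hdecomp]
  calc _ ≤ q (∑ K ∈ Finset.range (J + 1), Vk.toOT N K (Vk.of (hmem K))) +
        q (Vk.toOT N k (Vk.of hrem.1)) := map_add_le_add q _ _
    _ ≤ ∑ K ∈ Finset.range (J + 1), q (Vk.toOT N K (Vk.of (hmem K))) + 1 / 2 :=
        add_le_add (Finset.le_sum_of_subadditive q (map_zero q).le (map_add_le_add q) _ _) hremq
    _ ≤ ∑ K ∈ Finset.range (J + 1), ((2 : ℝ) ^ (K + 2))⁻¹ + 1 / 2 :=
        add_le_add (Finset.sum_le_sum fun K _ => hpiece K) le_rfl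
    _ ≤ 1 := by linarith [sum_two_inv_pow_le (J + 1)]

open scoped ComplexOrder in
-- The nonnegative elements of ℂ in its partial order are the nonnegative reals, so real convexity
-- and complex convexity agree. This makes the complex seminorms on 𝒪_T available.
instance (N : ℕ) : LocallyConvexSpace ℂ (OT N) := by
  refine LocallyConvexSpace.ofBasisZero ℂ (OT N) id
    (fun s => s ∈ 𝓝 (0 : OT N) ∧ Convex ℝ s) (LocallyConvexSpace.convex_basis_zero ℝ (OT N))
    fun s hs => ?_
  exact convex_of_nonneg_surjective_algebraMap _
    (fun _ hz => RCLike.nonneg_iff_exists_ofReal.mp hz) hs.2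

open scoped ComplexOrder in
-- The continuous seminorms define the topology of 𝒪_T, and a seminorm whose unit ball is a
-- neighbourhood of 0 is continuous.
theorem continuous_twistMap_left (σ : ℝ) (f : S2 N) : Continuous fun T => twistMap N σ T f := by
  have : ContinuousSMul ℝ (OT N) := IsScalarTower.continuousSMul ℂ
  have : PolynormableSpace ℂ (OT N) := LocallyConvexSpace.toPolynormableSpace
  refine (PolynormableSpace.withSeminorms ℂ (OT N)).continuous_of_continuous_comp
    ((twistMap N σ).flip f) fun q => ?_
  exact Seminorm.continuous' (r := 1) (closedBall_mem_nhds_twistMap σ f q.2)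

/-! ### Reduction of twisted products to twisted convolutions -/

theorem check_check (f : S2 N) : check (check f) = f := by
  ext u; simp [check_apply]

/-- Both sides are double integrals of f(s) h(u) against the same phase, by Fubini. This moves the
Fourier transform from the test function h to f, so that h × f becomes a twisted convolution of h
with a fixed function. -/
theorem twistedConv_sympFourier (h f : S2 N) :
    twistedConv (sympFourier h) f = twistedConv h (check (sympFourier f)) := by
  ext t
  rw [twistedConv_apply, twistedConv_apply, ← integral_sub_left_eq_self
    (fun s => h (t - s) * check (sympFourier f) s * Complex.exp (-(Complex.I * (symp t s : ℂ))))
    (dx N) t]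
  have hint : Integrable (fun x : Phase N × Phase N =>
      f x.1 * h x.2 * (Complex.exp (-(Complex.I * (symp x.2 (t - x.1) : ℂ))) *
        Complex.exp (-(Complex.I * (symp t x.1 : ℂ))))) ((dx N).prod (dx N)) := by
    refine ((f.integrable (μ := dx N)).mul_prod (h.integrable (μ := dx N))).norm.mono' ?_
      (ae_of_all _ fun x => ?_)
    · have h1 : Continuous fun x : Phase N × Phase N => symp x.2 (t - x.1) :=
        continuous_symp.comp (by fun_prop : Continuous fun x : Phase N × Phase N => (x.2, t - x.1))
      have h2 : Continuous fun x : Phase N × Phase N => symp t x.1 :=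
        continuous_symp.comp (by fun_prop : Continuous fun x : Phase N × Phase N => (t, x.1))
      have := f.continuous
      have := h.continuous
      exact Continuous.aestronglyMeasurable (by fun_prop)
    · rw [norm_mul _ (_ * _), norm_mul (Complex.exp _), norm_phase, norm_phase, mul_one, mul_one]
  calc _ = ∫ s, ∫ u, f s * h u * (Complex.exp (-(Complex.I * (symp u (t - s) : ℂ))) *
        Complex.exp (-(Complex.I * (symp t s : ℂ)))) ∂(dx N) ∂(dx N) := by
        congr 1
        ext s
        rw [sympFourier_apply, mul_assoc, ← integral_mul_const]
        congr 1
        ext u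
        ring
    _ = ∫ u, ∫ s, f s * h u * (Complex.exp (-(Complex.I * (symp u (t - s) : ℂ))) *
        Complex.exp (-(Complex.I * (symp t s : ℂ)))) ∂(dx N) ∂(dx N) :=
        integral_integral_swap hint
    _ = _ := by
        congr 1
        ext u
        rw [check_apply, neg_sub, sub_sub_cancel, sympFourier_apply, mul_assoc,
          ← integral_mul_const, ← integral_const_mul]
        congr 1
        ext s
        rw [← Complex.exp_add, mul_assoc (f s) (Complex.exp _), ← Complex.exp_add]
        -- By bilinearity and antisymmetry, u'J(t - s) + t'Js = s'J(u - t) + t'J(t - u).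
        have : -(Complex.I * (symp u (t - s) : ℂ)) + -(Complex.I * (symp t s : ℂ)) =
            -(Complex.I * (symp s (u - t) : ℂ)) + -(Complex.I * (symp t (t - u) : ℂ)) := by
          simp only [symp_sub_left, symp_sub_right, symp_self, symp_swap s]
          rw [symp_swap u t]
          push_cast
          ring
        rw [this]
        ring

theorem distProd_eq (T : S2' N) (f : S2 N) :
    distProd T f = distConv T (check (sympFourier f)) := by
  ext h
  change T (twistedProd f h) = T (twistedConv (check (check (sympFourier f))) h)
  rw [check_check, twistedProd_eq]

theorem prodDist_eq (f : S2 N) (T : S2' N) : prodDist f T = convDist (sympFourier f) T := by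
  ext h
  change T (twistedProd h f) = T (twistedConv h (check (sympFourier f)))
  rw [twistedProd_eq, twistedConv_sympFourier]

theorem isFunction_distConv (T : S2' N) (f : S2 N) :
    IsFunction (distConv T f) (twistMap N 1 T f) :=
  distConv_apply_eq_integral T f

theorem isFunction_convDist (f : S2 N) (T : S2' N) :
    IsFunction (convDist f T) (twistMap N (-1) T f) :=
  convDist_apply_eq_integral T f

end Moyal

end

/-- For every `T ∈ 𝓢₂'` and `f ∈ 𝓢₂`, each of the four distributions is a (unique) function in
`𝒪_T`, and the resulting bilinear maps into `𝒪_T` are separately continuous. -/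
theorem theorem3 (N : ℕ) :
    (∃ Φ : S2' N →ₗ[ℂ] S2 N →ₗ[ℂ] OT N,
      (∀ T f, IsFunction (distProd T f) (Φ T f)) ∧
      (∀ T, Continuous fun f => Φ T f) ∧ (∀ f, Continuous fun T => Φ T f)) ∧
    (∃ Φ : S2' N →ₗ[ℂ] S2 N →ₗ[ℂ] OT N,
      (∀ T f, IsFunction (prodDist f T) (Φ T f)) ∧
      (∀ T, Continuous fun f => Φ T f) ∧ (∀ f, Continuous fun T => Φ T f)) ∧
    (∃ Φ : S2' N →ₗ[ℂ] S2 N →ₗ[ℂ] OT N,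
      (∀ T f, IsFunction (distConv T f) (Φ T f)) ∧
      (∀ T, Continuous fun f => Φ T f) ∧ (∀ f, Continuous fun T => Φ T f)) ∧
    (∃ Φ : S2' N →ₗ[ℂ] S2 N →ₗ[ℂ] OT N,
      (∀ T f, IsFunction (convDist f T) (Φ T f)) ∧
      (∀ T, Continuous fun f => Φ T f) ∧ (∀ f, Continuous fun T => Φ T f)) := by
  -- The two products are the two convolution maps precomposed in f with continuous operators: the
  -- reflected transform for T × f, the transform itself for f × T.
  refine ⟨⟨(twistMap N 1).compl₂ (check.comp sympFourier).toLinearMap, fun T f => ?_, fun T => ?_,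
      fun f => continuous_twistMap_left 1 (check (sympFourier f))⟩,
    ⟨(twistMap N (-1)).compl₂ sympFourier.toLinearMap, fun T f => ?_, fun T => ?_,
      fun f => continuous_twistMap_left (-1) (sympFourier f)⟩,
    ⟨twistMap N 1, isFunction_distConv, continuous_twistMap_right 1,
      continuous_twistMap_left 1⟩,
    ⟨twistMap N (-1), fun T f => isFunction_convDist f T, continuous_twistMap_right (-1),
      continuous_twistMap_left (-1)⟩⟩
  · rw [distProd_eq]
    exact isFunction_distConv T (check (sympFourier f))
  · exact (continuous_twistMap_right 1 T).comp (check.comp sympFourier).continuous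
  · rw [prodDist_eq]
    exact isFunction_convDist (sympFourier f) T
  · exact (continuous_twistMap_right (-1) T).comp sympFourier.continuous
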